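/- Let $T>0$, $R>0$. Let $F\in C^1_c(\mathbb R)$ be even and nonnegative, and let $f_0\in C^1(\mathbb R^2)$ be nonnegative, compactly supported in $v$ uniformly in $x$ (there is $P$ with $f_0(x,v)=0$ for all $x$ and all $|v|>P$), with $f_0(x,v)=F(v)$ for all $|x|>R$, $v\in\mathbb R$. Let $f\in C^1([0,T]\times\mathbb R^2)$ be a solution of the one-dimensional Vlasov–Poisson system $$\partial_t f+v\,\partial_x f-E\,\partial_v f=0,\qquad \rho(t,x)=\int_{\mathbb R}\bigl(F(v)-f(t,x,v)\bigr)\,dv,$$ $$E(t,x)=\tfrac12\Bigl(\int_{-\infty}^x\rho(t,y)\,dy-\int_x^\infty\rho(t,y)\,dy\Bigr),\qquad f(0,x,v)=f_0(x,v)$$ on $[0,T]\times\mathbb R^2$ (in particular the integrals defining $\rho$ and $E$ converge absolutely), and assume that $\int_0^T\|E(\tau)\|_\infty\,d\tau<\infty$, where $\|E(\tau)\|_\infty=\sup_{x}|E(\tau,x)|$. For $t\in[0,T]$ put $$Q_g(t)=\sup\{|v| : F(v)-f(\tau,x,v)\neq0\ \text{for some } x\in\mathbb R,\ \tau\in[0,t]\}$$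 (with $\sup\emptyset=0$) and $$R(t)=R+t\,Q_g(t)+\int_0^t\int_\tau^t\|E(s)\|_\infty\,ds\,d\tau .$$ Let $\operatorname{sign}(x)=1$ for $x\ge0$ and $-1$ for $x<0$, and $$E^0=\frac12\int_{-R}^{R}\int_{\mathbb R}\bigl(F(v)-f_0(y,v)\bigr)\,dv\,dy,\qquad \omega=\Bigl(\int_{\mathbb R}F(v)\,dv\Bigr)^{1/2}.$$ Then for every $t\in[0,T]$ and every $x$ with $|x|>R(t)$, $$E(t,x)=E^0\operatorname{sign}(x)\cos(\omega t)$$ and, for every $v\in\mathbb R$, $$f(t,x,v)=F\Bigl(v+\frac{E^0\operatorname{sign}(x)}{\omega}\sin(\omega t)\Bigr).$$ (If $\omega=0$, then $F\equiv0$ and the last identity reads $f(t,x,v)=0$.) -/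

import Mathlib

open MeasureTheory Set

namespace VlasovPoisson

noncomputable section

/-- The charge density `ρ(t,x) = ∫ (F(v) - f(t,x,v)) dv`. -/
def chargeDensity (F : ℝ → ℝ) (f : ℝ → ℝ → ℝ → ℝ) (t x : ℝ) : ℝ :=
  ∫ v, (F v - f t x v)

/-- The electric field
`E(t,x) = (1/2) (∫_{-∞}^x ρ(t,y) dy - ∫_x^∞ ρ(t,y) dy)`. -/
def electricField (F : ℝ → ℝ) (f : ℝ → ℝ → ℝ → ℝ) (t x : ℝ) : ℝ :=
  (1 / 2) * ((∫ y in Iic x, chargeDensity F f t y) - ∫ y in Ioi x, chargeDensity F f t y)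

/-- `f` is a `C¹` solution on `[0,T] × ℝ²` of the one-dimensional Vlasov-Poisson system with
background `F` and initial datum `f₀`. The two integrability fields say that the integrals
defining `ρ` and `E` exist. The time derivative is one-sided at `t = 0` and `t = T`. -/
structure IsC1Solution (T : ℝ) (F : ℝ → ℝ) (f₀ : ℝ → ℝ → ℝ) (f : ℝ → ℝ → ℝ → ℝ) : Prop where
  contDiffOn : ContDiffOn ℝ 1 (fun p : ℝ × ℝ × ℝ => f p.1 p.2.1 p.2.2) (Icc 0 T ×ˢ univ)
  integrable_velocity : ∀ t ∈ Icc 0 T, ∀ x, Integrable (fun v => F v - f t x v)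
  integrable_density : ∀ t ∈ Icc 0 T, Integrable (fun x => chargeDensity F f t x)
  vlasov : ∀ t ∈ Icc 0 T, ∀ x v,
    derivWithin (fun τ => f τ x v) (Icc 0 T) t + v * deriv (fun y => f t y v) x
      - electricField F f t x * deriv (fun w => f t x w) v = 0
  initial : ∀ x v, f 0 x v = f₀ x v

/-- The assumptions on the data: `F ∈ C¹_c(ℝ)` is even and nonnegative, `f₀ ∈ C¹(ℝ²)` is
nonnegative and compactly supported in `v`, uniformly in `x`, and `f₀(x,v) = F(v)` for
`|x| > R`. -/
structure IsAdmissibleData (R : ℝ) (F : ℝ → ℝ) (f₀ : ℝ → ℝ → ℝ) : Prop where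
  radius_pos : 0 < R
  background_contDiff : ContDiff ℝ 1 F
  background_hasCompactSupport : HasCompactSupport F
  background_even : ∀ v, F (-v) = F v
  background_nonneg : ∀ v, 0 ≤ F v
  initial_contDiff : ContDiff ℝ 1 (fun p : ℝ × ℝ => f₀ p.1 p.2)
  initial_velocity_support : ∃ P : ℝ, ∀ x v, P < |v| → f₀ x v = 0
  initial_nonneg : ∀ x v, 0 ≤ f₀ x v
  initial_eq_background : ∀ x v, R < |x| → f₀ x v = F v

/-- `‖E(t)‖_∞ = sup_x |E(t,x)|`. -/
def fieldSupNorm (F : ℝ → ℝ) (f : ℝ → ℝ → ℝ → ℝ) (t : ℝ) : ℝ :=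
  ⨆ x : ℝ, |electricField F f t x|

/-- The field bound: `∫_0^T ‖E(τ)‖_∞ dτ ≤ C` for some `C > 0` (the integral being finite). -/
def HasFieldBound (T : ℝ) (F : ℝ → ℝ) (f : ℝ → ℝ → ℝ → ℝ) : Prop :=
  IntervalIntegrable (fieldSupNorm F f) volume 0 T ∧
    ∃ C : ℝ, 0 < C ∧ ∫ τ in (0 : ℝ)..T, fieldSupNorm F f τ ≤ C

/-- `Q_g(t)`: the supremum of `|v|` over those `v` for which `F(v) - f(τ,x,v) ≠ 0` for some
`x ∈ ℝ` and `τ ∈ [0,t]` (zero if there are none). -/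
def velocityRadius (F : ℝ → ℝ) (f : ℝ → ℝ → ℝ → ℝ) (t : ℝ) : ℝ :=
  sSup {r : ℝ | ∃ v x : ℝ, ∃ τ ∈ Icc 0 t, F v - f τ x v ≠ 0 ∧ r = |v|}

/-- `R(t) = R + t Q_g(t) + ∫_0^t ∫_τ^t ‖E(s)‖_∞ ds dτ`. -/
def spatialRadius (R : ℝ) (F : ℝ → ℝ) (f : ℝ → ℝ → ℝ → ℝ) (t : ℝ) : ℝ :=
  R + t * velocityRadius F f t + ∫ τ in (0 : ℝ)..t, ∫ s in τ..t, fieldSupNorm F f s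

/-- `sign(x) = 1` for `x ≥ 0` and `-1` for `x < 0`. -/
def sgn (x : ℝ) : ℝ := if 0 ≤ x then 1 else -1

/-- `E⁰ = (1/2) ∫_{-R}^R ∫ (F(v) - f₀(y,v)) dv dy`. -/
def initialFieldStrength (R : ℝ) (F : ℝ → ℝ) (f₀ : ℝ → ℝ → ℝ) : ℝ :=
  (1 / 2) * ∫ y in (-R)..R, ∫ v, (F v - f₀ y v)

/-- `ω = (∫ F(v) dv)^{1/2}`. -/
def frequency (F : ℝ → ℝ) : ℝ := √(∫ v, F v)

end

end VlasovPoisson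

/-! Write A(t) for half the total charge and a(t) for the integral of A over [0, t]. Since E(t, ±∞)
= ±A(t), particles very far out feel an almost spatially constant force, and following
characteristics back to time 0 gives f(t, ±y, v) → F(v ± a(t)) as y → ∞
(`IsC1Solution.tendsto_far`). As F is even, the momentum density tends to ∓ω² a(t). These two limits
cancel in the flux balance of charge, which leaves Ampère's law ∂_t E = ∫ v f dv
(`IsC1Solution.electricField_time_sub`). Letting x → +∞ in it yields A' = -ω² a, a' = A, with A(0) =
E⁰ and a(0) = 0: a harmonic oscillator (`IsC1Solution.halfCharge_eq_cos`).

To descend from infinity to |x| > R(t), note that R(t) is built so that a backward characteristic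
starting there with |v| ≤ Q_g(t) keeps |X(s)| > R(s) and its sign
(`HasVelocityBound.spatialRadius_add_le`); for larger |v| the solution is just F. Hence an exterior
error in E produces a proportional error in f, and Ampère's law turns it into a time integral of
itself. Iterating bounds the error by M (ct)^n / n!, so it vanishes
(`IsC1Solution.electricField_exterior`).

All of this uses exact characteristics and a uniform velocity support, neither of which is assumed:
at the outset E is only measurable in time, uniformly continuous in space and dominated by an
integrable function of time. So E is first replaced by regular fields close to it in L¹ in time.
Along their trajectories f is nearly constant, because its rate of change is (E - G) ∂_v f
(`IsC1Solution.exists_initial_near`). This bounds the velocity support of f; the charge balance then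
makes E Lipschitz in space and time, and true characteristics exist. -/

namespace VlasovPoisson

open Filter Topology
open scoped NNReal

/-! ### Piecewise linear partition of unity -/

/-- The truncation of the real line to `[0, 1]`. -/
noncomputable def unitClip (x : ℝ) : ℝ := max 0 (min 1 x)

lemma lipschitzWith_unitClip : LipschitzWith 1 unitClip :=
  (LipschitzWith.id.const_min 1).const_max 0

lemma unitClip_mono : Monotone unitClip := fun _ _ h =>
  max_le_max_left 0 (min_le_min_left 1 h)

lemma unitClip_of_nonpos {x : ℝ} (h : x ≤ 0) : unitClip x = 0 := by
  simp [unitClip, h]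

lemma unitClip_of_one_le {x : ℝ} (h : 1 ≤ x) : unitClip x = 1 := by
  simp [unitClip, h]

/-- The piecewise linear bump of the uniform grid, supported in `[i, i + 2]`. -/
noncomputable def hat (i : ℕ) (x : ℝ) : ℝ := unitClip (x - i) - unitClip (x - (i + 1 : ℕ))

lemma hat_nonneg (i : ℕ) (x : ℝ) : 0 ≤ hat i x := by
  refine sub_nonneg.2 (unitClip_mono ?_)
  push_cast; linarith

lemma hat_eq_zero {i : ℕ} {x : ℝ} (h : 1 < |x - (i + 1)|) : hat i x = 0 := by
  unfold hat
  push_cast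
  rcases lt_abs.1 h with h | h
  · rw [unitClip_of_one_le (by linarith), unitClip_of_one_le (by linarith), sub_self]
  · rw [unitClip_of_nonpos (by linarith), unitClip_of_nonpos (by linarith), sub_self]

/-- The sum telescopes; the first cell and everything beyond `N` are excluded because the end terms
are not saturated there. -/
lemma sum_hat {N : ℕ} {x : ℝ} (h₁ : 1 ≤ x) (h₂ : x ≤ N) : ∑ i ∈ Finset.range N, hat i x = 1 := by
  unfold hat
  rw [Finset.sum_range_sub' (fun i : ℕ => unitClip (x - i)), unitClip_of_one_le (by simpa using h₁),
    unitClip_of_nonpos (by linarith), sub_zero]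

lemma hat_sub_le (i : ℕ) (x y : ℝ) : |hat i x - hat i y| ≤ 2 * |x - y| := by
  have h (c : ℝ) : |unitClip (x - c) - unitClip (y - c)| ≤ |x - y| := by
    simpa [Real.dist_eq] using lipschitzWith_unitClip.dist_le_mul (x - c) (y - c)
  calc |hat i x - hat i y|
      = |(unitClip (x - i) - unitClip (y - i)) -
          (unitClip (x - (i + 1 : ℕ)) - unitClip (y - (i + 1 : ℕ)))| := by
        unfold hat; congr 1; ring
    _ ≤ |unitClip (x - i) - unitClip (y - i)| +
          |unitClip (x - (i + 1 : ℕ)) - unitClip (y - (i + 1 : ℕ))| := abs_sub _ _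
    _ ≤ 2 * |x - y| := by linarith [h i, h (i + 1 : ℕ)]

/-- The weights sum to one, so the error is a convex combination of local oscillations plus the cost
of replacing the samples `b` by `b'`. It will be used with `b` the samples of the field at grid
points and `b'` their continuous-in-time substitutes. -/
lemma abs_sum_hat_mul_sub_le {N : ℕ} {z c W : ℝ} {b b' : ℕ → ℝ} (h₁ : 1 ≤ z) (h₂ : z ≤ N)
    (hW : ∀ i : ℕ, |z - (i + 1)| ≤ 1 → |c - b i| ≤ W) :
    |c - ∑ i ∈ Finset.range N, hat i z * b' i| ≤ W + ∑ i ∈ Finset.range N, |b i - b' i| := by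
  have key : c - ∑ i ∈ Finset.range N, hat i z * b' i
      = ∑ i ∈ Finset.range N, (hat i z * (c - b i) + hat i z * (b i - b' i)) := by
    have h1 : ∑ i ∈ Finset.range N, hat i z * c = c := by
      rw [← Finset.sum_mul, sum_hat h₁ h₂, one_mul]
    calc _ = ∑ i ∈ Finset.range N, hat i z * c - ∑ i ∈ Finset.range N, hat i z * b' i := by rw [h1]
      _ = _ := by rw [← Finset.sum_sub_distrib]; exact Finset.sum_congr rfl fun i _ => by ring
  have hle1 : ∀ i ∈ Finset.range N, hat i z ≤ 1 := fun i hi => by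
    rw [← sum_hat h₁ h₂]
    exact Finset.single_le_sum (f := fun i => hat i z) (fun j _ => hat_nonneg j z) hi
  rw [key, Finset.sum_add_distrib]
  refine (abs_add_le _ _).trans (add_le_add ?_ ?_)
  · refine (Finset.abs_sum_le_sum_abs _ _).trans ?_
    calc ∑ i ∈ Finset.range N, |hat i z * (c - b i)| ≤ ∑ i ∈ Finset.range N, hat i z * W := by
          refine Finset.sum_le_sum fun i _ => ?_
          rw [abs_mul, abs_of_nonneg (hat_nonneg i z)]
          by_cases h : |z - (i + 1)| ≤ 1
          · exact mul_le_mul_of_nonneg_left (hW i h) (hat_nonneg i z)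
          · rw [hat_eq_zero (not_le.1 h)]; simp
      _ = W := by rw [← Finset.sum_mul, sum_hat h₁ h₂, one_mul]
  · refine (Finset.abs_sum_le_sum_abs _ _).trans (Finset.sum_le_sum fun i hi => ?_)
    rw [abs_mul, abs_of_nonneg (hat_nonneg i z)]
    exact mul_le_of_le_one_left (abs_nonneg _) (hle1 i hi)

/-! ### Approximation of a rough field in L¹ in time -/

/-- The modulus of continuity of `φ` at scale `δ`, computed on rational points. -/
noncomputable def ratModulus (φ : ℝ → ℝ) (δ : ℝ) : ℝ :=
  ⨆ p : ℚ × ℚ, if |(p.1 : ℝ) - p.2| < δ then |φ p.1 - φ p.2| else 0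

lemma bddAbove_ratModulus {φ : ℝ → ℝ} {B : ℝ} (hB : ∀ x, |φ x| ≤ B) (δ : ℝ) :
    BddAbove (range fun p : ℚ × ℚ => if |(p.1 : ℝ) - p.2| < δ then |φ p.1 - φ p.2| else 0) := by
  refine ⟨2 * B, ?_⟩
  rintro _ ⟨p, rfl⟩
  dsimp only
  split_ifs
  · exact (abs_sub _ _).trans (by linarith [hB p.1, hB p.2])
  · linarith [hB 0, abs_nonneg (φ 0)]

lemma ratModulus_nonneg (φ : ℝ → ℝ) (δ : ℝ) : 0 ≤ ratModulus φ δ :=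
  Real.iSup_nonneg fun p => by split_ifs <;> positivity

lemma ratModulus_le {φ : ℝ → ℝ} {B : ℝ} (hB : ∀ x, |φ x| ≤ B) (δ : ℝ) :
    ratModulus φ δ ≤ 2 * B := by
  refine ciSup_le fun p => ?_
  split_ifs
  · exact (abs_sub _ _).trans (by linarith [hB p.1, hB p.2])
  · linarith [hB 0, abs_nonneg (φ 0)]

/-- The condition `|x - y| < δ` is open, so rational pairs are dense in it, and the bound is closed.
Restricting to rationals loses nothing, while keeping the supremum countable and hence measurable in
time. -/
lemma abs_sub_le_ratModulus {φ : ℝ → ℝ} {B : ℝ} (hφ : Continuous φ) (hB : ∀ x, |φ x| ≤ B) {δ x y : ℝ}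
    (h : |x - y| < δ) : |φ x - φ y| ≤ ratModulus φ δ := by
  have hU : IsOpen {p : ℝ × ℝ | |p.1 - p.2| < δ} :=
    isOpen_lt (by fun_prop) continuous_const
  have hD : DenseRange (fun p : ℚ × ℚ => ((p.1 : ℝ), (p.2 : ℝ))) :=
    Rat.denseRange_cast.prodMap Rat.denseRange_cast
  have hC : IsClosed {p : ℝ × ℝ | |φ p.1 - φ p.2| ≤ ratModulus φ δ} :=
    isClosed_le (by fun_prop) continuous_const
  have hmem : ((x, y) : ℝ × ℝ) ∈ closure ({p : ℝ × ℝ | |p.1 - p.2| < δ} ∩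
      range (fun p : ℚ × ℚ => ((p.1 : ℝ), (p.2 : ℝ)))) :=
    Dense.open_subset_closure_inter hD hU h
  have hsub : ({p : ℝ × ℝ | |p.1 - p.2| < δ} ∩
      range (fun p : ℚ × ℚ => ((p.1 : ℝ), (p.2 : ℝ)))) ⊆
      {p : ℝ × ℝ | |φ p.1 - φ p.2| ≤ ratModulus φ δ} := by
    rintro _ ⟨hq, p, rfl⟩
    have := le_ciSup (bddAbove_ratModulus hB δ) p
    rwa [if_pos (show |(p.1 : ℝ) - p.2| < δ from hq)] at this
  exact closure_minimal hsub hC hmem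

lemma tendsto_ratModulus {φ : ℝ → ℝ} (hφ : UniformContinuous φ) :
    Tendsto (fun n : ℕ => ratModulus φ (1 / ((n : ℝ) + 1))) atTop (𝓝 0) := by
  rw [Metric.tendsto_atTop]
  intro ε hε
  obtain ⟨δ, hδ, h⟩ := Metric.uniformContinuous_iff.1 hφ (ε / 2) (by positivity)
  obtain ⟨N, hN⟩ := exists_nat_one_div_lt hδ
  refine ⟨N, fun n hn => ?_⟩
  rw [Real.dist_eq, sub_zero, abs_of_nonneg (ratModulus_nonneg _ _)]
  refine lt_of_le_of_lt (ciSup_le fun p => ?_) (half_lt_self hε)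
  split_ifs with hp
  · have h1 : (1 : ℝ) / (n + 1) ≤ 1 / (N + 1) :=
      Nat.one_div_le_one_div hn
    exact (h (show dist (p.1 : ℝ) p.2 < δ by rw [Real.dist_eq]; linarith)).le
  · positivity

/-- An integrable function on `(0, T]` is approximated in `L¹` by a continuous bounded one. -/
lemma exists_continuous_integral_abs_sub_le {T : ℝ} (hT : 0 ≤ T) {u : ℝ → ℝ}
    (hu : IntervalIntegrable u volume 0 T) {ε : ℝ} (hε : 0 < ε) :
    ∃ g : ℝ → ℝ, Continuous g ∧ (∃ B, ∀ s, |g s| ≤ B) ∧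
      IntervalIntegrable (fun s => |u s - g s|) volume 0 T ∧ ∫ s in 0..T, |u s - g s| ≤ ε := by
  have hu' : IntegrableOn u (Ioc 0 T) := (intervalIntegrable_iff_integrableOn_Ioc_of_le hT).1 hu
  obtain ⟨g, hgc, hle, hg, hgi⟩ :=
    (hu'.integrable_indicator measurableSet_Ioc).exists_hasCompactSupport_integral_sub_le hε
  obtain ⟨B, hB⟩ := hgc.exists_bound_of_continuous hg
  refine ⟨g, hg, ⟨B, hB⟩, (hu.sub (hg.intervalIntegrable _ _)).abs, ?_⟩
  rw [intervalIntegral.integral_of_le hT]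
  calc ∫ s in Ioc 0 T, |u s - g s|
      = ∫ s in Ioc 0 T, ‖(Ioc 0 T).indicator u s - g s‖ := by
        refine setIntegral_congr_fun measurableSet_Ioc fun s hs => ?_
        simp only [indicator_of_mem hs, Real.norm_eq_abs]
    _ ≤ ∫ s, ‖(Ioc 0 T).indicator u s - g s‖ :=
        setIntegral_le_integral ((hu'.integrable_indicator measurableSet_Ioc).sub hgi).norm
          (Eventually.of_forall fun s => norm_nonneg _)
    _ ≤ ε := hle

/-- At each time the modulus tends to zero with the scale, and `2 * e` dominates it, so dominated
convergence applies. -/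
lemma exists_integral_ratModulus_le {T : ℝ} (hT : 0 ≤ T) {E : ℝ → ℝ → ℝ} {e : ℝ → ℝ}
    (he : IntervalIntegrable e volume 0 T) (hm : ∀ x, Measurable fun s => E s x)
    (hEe : ∀ s ∈ Icc 0 T, ∀ x, |E s x| ≤ e s) (hu : ∀ s ∈ Icc 0 T, UniformContinuous (E s))
    {ε : ℝ} (hε : 0 < ε) :
    ∃ δ > 0, IntervalIntegrable (fun s => ratModulus (E s) δ) volume 0 T ∧
      ∫ s in 0..T, ratModulus (E s) δ ≤ ε := by
  have hmeas (δ : ℝ) : Measurable fun s => ratModulus (E s) δ := by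
    refine Measurable.iSup fun p => ?_
    split_ifs
    · exact ((hm _).sub (hm _)).abs
    · exact measurable_const
  have hmem : ∀ s ∈ uIoc 0 T, s ∈ Icc 0 T := fun s hs => by
    rw [uIoc_of_le hT] at hs; exact Ioc_subset_Icc_self hs
  have hbound (δ : ℝ) : ∀ s ∈ uIoc 0 T, ‖ratModulus (E s) δ‖ ≤ 2 * e s := fun s hs => by
    rw [Real.norm_eq_abs, abs_of_nonneg (ratModulus_nonneg _ _)]
    exact ratModulus_le (hEe s (hmem s hs)) δ
  have hint (δ : ℝ) : IntervalIntegrable (fun s => ratModulus (E s) δ) volume 0 T := by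
    refine (he.const_mul 2).mono_fun (hmeas δ).aestronglyMeasurable ?_
    filter_upwards [ae_restrict_mem measurableSet_uIoc] with s hs
    exact (hbound δ s hs).trans (le_abs_self _)
  have hlim : Tendsto (fun n : ℕ => ∫ s in 0..T, ratModulus (E s) (1 / ((n : ℝ) + 1))) atTop
      (𝓝 (∫ _ in 0..T, (0 : ℝ))) := by
    refine intervalIntegral.tendsto_integral_filter_of_dominated_convergence (fun s => 2 * e s)
      (Eventually.of_forall fun n => (hmeas _).aestronglyMeasurable)
      (Eventually.of_forall fun n => Eventually.of_forall fun s hs => hbound _ s hs)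
      (he.const_mul 2) (Eventually.of_forall fun s hs => tendsto_ratModulus (hu s (hmem s hs)))
  rw [intervalIntegral.integral_zero] at hlim
  obtain ⟨n, hn⟩ := (hlim.eventually (gt_mem_nhds hε)).exists
  exact ⟨_, Nat.one_div_pos_of_nat, hint _, hn.le⟩

/-- A field that is measurable in time, uniformly continuous in space and dominated by an
integrable function of time is approximated, on a bounded set of positions and in `L¹` in time,
by fields that are continuous in time, Lipschitz in space and bounded. -/
lemma exists_lipschitz_approx {T K : ℝ} (hT : 0 ≤ T) (hK : 0 < K) {E : ℝ → ℝ → ℝ} {e : ℝ → ℝ}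
    (he : IntervalIntegrable e volume 0 T) (hm : ∀ x, Measurable fun s => E s x)
    (hEe : ∀ s ∈ Icc 0 T, ∀ x, |E s x| ≤ e s) (hu : ∀ s ∈ Icc 0 T, UniformContinuous (E s))
    {ε : ℝ} (hε : 0 < ε) :
    ∃ G : ℝ → ℝ → ℝ, (∀ x, Continuous fun s => G s x) ∧ (∃ L : ℝ≥0, ∀ s, LipschitzWith L (G s)) ∧
      (∃ B, ∀ s x, |G s x| ≤ B) ∧ ∃ w : ℝ → ℝ, IntervalIntegrable w volume 0 T ∧
      ∫ s in 0..T, w s ≤ ε ∧ ∀ s ∈ Icc 0 T, (∀ x, |x| ≤ K → |E s x - G s x| ≤ w s) ∧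
        ∀ x, |G s x| ≤ e s + w s := by
  obtain ⟨δ, hδ, hWi, hW⟩ := exists_integral_ratModulus_le hT he hm hEe hu (half_pos hε)
  -- Every node active at a point lies within `h`; taking `h` below `δ` gives the strict inequality
  -- that `ratModulus` asks for.
  set h : ℝ := δ / 2 with hh
  have hh0 : 0 < h := half_pos hδ
  obtain ⟨N, hN⟩ := exists_nat_ge (2 * K / h + 1)
  have hN0 : (0 : ℝ) < N := lt_of_lt_of_le (by positivity) hN
  have hEint (x : ℝ) : IntervalIntegrable (fun s => E s x) volume 0 T := by
    refine he.mono_fun (hm x).aestronglyMeasurable ?_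
    filter_upwards [ae_restrict_mem measurableSet_uIoc] with s hs
    rw [uIoc_of_le hT] at hs
    exact (hEe s (Ioc_subset_Icc_self hs) x).trans (le_abs_self _)
  have hg (i : ℕ) := exists_continuous_integral_abs_sub_le hT (hEint (i * h - K))
    (ε := ε / 2 / N) (by positivity)
  choose g hgc hgB hgi hgε using hg
  choose B hB using hgB
  have hB0 (i : ℕ) : 0 ≤ B i := (abs_nonneg _).trans (hB i 0)
  -- Clipping the position makes the approximation globally bounded and Lipschitz without altering
  -- it on `[-K, K]`.
  set clip : ℝ → ℝ := fun x => max (-K) (min K x) with hclip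
  have hclipL : LipschitzWith 1 clip := (LipschitzWith.id.const_min K).const_max (-K)
  have hclip_abs (x : ℝ) : |clip x| ≤ K :=
    abs_le.2 ⟨le_max_left _ _, max_le (by linarith) (min_le_left _ _)⟩
  have hclip_eq {x : ℝ} (hx : |x| ≤ K) : clip x = x := by
    rw [abs_le] at hx
    simp [hclip, hx.1, hx.2]
  -- Spatial interpolation of the samples. The shift by 1 enters the range of `sum_hat` and matches
  -- the centre `i + 1` of `hat i` with the node `i * h - K`.
  set G : ℝ → ℝ → ℝ := fun s x =>
    ∑ i ∈ Finset.range N, hat i ((clip x + K) / h + 1) * g i s with hG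
  set w : ℝ → ℝ := fun s => ratModulus (E s) δ +
    ∑ i ∈ Finset.range N, |E s (i * h - K) - g i s| with hw
  have happ : ∀ s ∈ Icc 0 T, ∀ x, |E s (clip x) - G s x| ≤ w s := by
    intro s hs x
    have hc := abs_le.1 (hclip_abs x)
    have hz1 : 1 ≤ (clip x + K) / h + 1 := by
      have : 0 ≤ (clip x + K) / h := div_nonneg (by linarith) hh0.le
      linarith
    have hz2 : (clip x + K) / h + 1 ≤ N := by
      have : (clip x + K) / h ≤ 2 * K / h := by gcongr; linarith
      linarith
    refine abs_sum_hat_mul_sub_le (b := fun i => E s (i * h - K)) hz1 hz2 fun i hi => ?_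
    refine abs_sub_le_ratModulus (hu s hs).continuous (hEe s hs) ?_
    have : clip x - (i * h - K) = h * ((clip x + K) / h + 1 - (i + 1)) := by
      field_simp; ring
    rw [this, abs_mul, abs_of_pos hh0]
    calc h * _ ≤ h * 1 := by gcongr
      _ < δ := by rw [mul_one, hh]; linarith
  refine ⟨G, fun x => by fun_prop, ?_, ⟨∑ i ∈ Finset.range N, B i, fun s x => ?_⟩, w, ?_, ?_, ?_⟩
  · refine ⟨Real.toNNReal (∑ i ∈ Finset.range N, 2 * (1 / h) * B i), fun s => ?_⟩
    refine LipschitzWith.of_dist_le_mul fun x y => ?_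
    rw [Real.coe_toNNReal _ (Finset.sum_nonneg fun i _ => by have := hB0 i; positivity),
      Real.dist_eq, Real.dist_eq, hG]
    dsimp only
    rw [← Finset.sum_sub_distrib, Finset.sum_mul]
    refine (Finset.abs_sum_le_sum_abs _ _).trans (Finset.sum_le_sum fun i _ => ?_)
    rw [← sub_mul, abs_mul]
    have h1 := hat_sub_le i ((clip x + K) / h + 1) ((clip y + K) / h + 1)
    have h2 : |clip x - clip y| ≤ |x - y| := by
      simpa [Real.dist_eq] using hclipL.dist_le_mul x y
    have h3 : (clip x + K) / h + 1 - ((clip y + K) / h + 1) = (1 / h) * (clip x - clip y) := by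
      ring
    rw [h3, abs_mul, abs_of_pos (one_div_pos.2 hh0)] at h1
    have h4 : |hat i ((clip x + K) / h + 1) - hat i ((clip y + K) / h + 1)|
        ≤ 2 * (1 / h * |x - y|) := h1.trans (by gcongr)
    calc _ ≤ 2 * (1 / h * |x - y|) * B i :=
          mul_le_mul h4 (hB i s) (abs_nonneg _) (by positivity)
      _ = _ := by ring
  · refine (Finset.abs_sum_le_sum_abs _ _).trans (Finset.sum_le_sum fun i _ => ?_)
    rw [abs_mul]
    have h1 : |hat i ((clip x + K) / h + 1)| ≤ 1 := by
      have hc (y : ℝ) : 0 ≤ unitClip y ∧ unitClip y ≤ 1 :=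
        ⟨le_max_left _ _, max_le zero_le_one (min_le_left _ _)⟩
      unfold hat
      rw [abs_le]
      constructor <;> linarith [hc ((clip x + K) / h + 1 - i),
        hc ((clip x + K) / h + 1 - (i + 1 : ℕ))]
    exact (mul_le_of_le_one_left (abs_nonneg _) h1).trans (hB i s)
  · refine hWi.add ?_
    have := IntervalIntegrable.sum (Finset.range N) (f := fun i s => |E s (i * h - K) - g i s|)
      (μ := volume) (a := 0) (b := T) (fun i _ => hgi i)
    simpa [Finset.sum_fn] using this
  · have hsum : IntervalIntegrable (fun s => ∑ i ∈ Finset.range N, |E s (i * h - K) - g i s|)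
        volume 0 T := by
      have := IntervalIntegrable.sum (Finset.range N) (f := fun i s => |E s (i * h - K) - g i s|)
        (μ := volume) (a := 0) (b := T) (fun i _ => hgi i)
      simpa [Finset.sum_fn] using this
    rw [hw, intervalIntegral.integral_add hWi hsum,
      intervalIntegral.integral_finsetSum fun i _ => hgi i]
    calc _ ≤ ε / 2 + ∑ i ∈ Finset.range N, ε / 2 / N :=
          add_le_add hW (Finset.sum_le_sum fun i _ => hgε i)
      _ = ε := by
        rw [Finset.sum_const, Finset.card_range, nsmul_eq_mul]
        field_simp
        ring
  · intro s hs
    refine ⟨fun x hx => ?_, fun x => ?_⟩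
    · have := happ s hs x
      rwa [hclip_eq hx] at this
    · have h1 := happ s hs x
      have h2 := hEe s hs (clip x)
      have h3 := abs_sub_abs_le_abs_sub (G s x) (E s (clip x))
      rw [abs_sub_comm] at h3
      linarith

/-! ### Trajectories of a prescribed acceleration -/

/-- Trajectories of `X' = V`, `V' = -G(s, X)` on `[0, t]` with prescribed state at time `t`. -/
lemma exists_trajectory {t : ℝ} (ht : 0 ≤ t) {G : ℝ → ℝ → ℝ} {L : ℝ≥0} {B : ℝ}
    (hc : ∀ x, ContinuousOn (fun s => G s x) (Icc 0 t))
    (hL : ∀ s ∈ Icc 0 t, LipschitzWith L (G s)) (hB : ∀ s ∈ Icc 0 t, ∀ x, |G s x| ≤ B) (x v : ℝ) :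
    ∃ X V : ℝ → ℝ, X t = x ∧ V t = v ∧
      (∀ s ∈ Icc 0 t, HasDerivWithinAt X (V s) (Icc 0 t) s) ∧
      ∀ s ∈ Icc 0 t, HasDerivWithinAt V (-G s (X s)) (Icc 0 t) s := by
  have hB0 : 0 ≤ B := (abs_nonneg _).trans (hB 0 ⟨le_rfl, ht⟩ 0)
  -- An a priori bound on the speed. Clipping the velocity at `N` makes the vector field bounded, so
  -- one Picard–Lindelöf step covers `[0, t]`; the bound then shows that the clip is never active.
  set N : ℝ := |v| + B * t with hN
  have hN0 : 0 ≤ N := by positivity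
  set clip : ℝ → ℝ := fun x => max (-N) (min N x) with hclip
  have hclipL : LipschitzWith 1 clip := (LipschitzWith.id.const_min N).const_max (-N)
  have hclip_abs (x : ℝ) : |clip x| ≤ N :=
    abs_le.2 ⟨le_max_left _ _, max_le (by linarith) (min_le_left _ _)⟩
  have hpl : IsPicardLindelof (fun s (p : ℝ × ℝ) => (clip p.2, -G s p.1))
      (⟨t, ht, le_rfl⟩ : Icc 0 t) (x, v) (Real.toNNReal (max N B * t)) 0 (Real.toNNReal (max N B))
      (max 1 L) := by
    refine ⟨fun s hs => LipschitzWith.lipschitzOnWith ?_, fun p _ => ?_, fun s hs p _ => ?_, ?_⟩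
    · have h1 : LipschitzWith (1 * 1) (fun p : ℝ × ℝ => clip p.2) :=
        hclipL.comp LipschitzWith.prod_snd
      have h2 : LipschitzWith (L * 1) (fun p : ℝ × ℝ => -G s p.1) :=
        ((hL s hs).comp LipschitzWith.prod_fst).neg
      simpa using h1.prodMk h2
    · exact continuousOn_const.prodMk (hc p.1).neg
    · rw [Real.coe_toNNReal _ (le_max_of_le_left hN0), Prod.norm_def]
      refine max_le_max ?_ ?_
      · exact hclip_abs _
      · simpa using hB s hs p.1
    · rw [Real.coe_toNNReal _ (le_max_of_le_left hN0),
        Real.coe_toNNReal _ (mul_nonneg (le_max_of_le_left hN0) ht)]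
      simp [ht]
  obtain ⟨α, hα0, hα⟩ := hpl.exists_eq_forall_mem_Icc_hasDerivWithinAt₀
  have hV : ∀ s ∈ Icc 0 t, HasDerivWithinAt (fun s => (α s).2) (-G s (α s).1) (Icc 0 t) s :=
    fun s hs => (hα s hs).snd
  have hVbound : ∀ s ∈ Icc 0 t, |(α s).2| ≤ N := by
    intro s hs
    have h1 := Convex.norm_image_sub_le_of_norm_hasDerivWithin_le (C := B) hV
      (fun r hr => by simpa using hB r hr _) (convex_Icc 0 t) (⟨ht, le_rfl⟩ : t ∈ Icc 0 t) hs
    have h2 : (α t).2 = v := by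
      have : α t = (x, v) := hα0
      rw [this]
    rw [h2, Real.norm_eq_abs, Real.norm_eq_abs] at h1
    have h3 : |s - t| ≤ t := by rw [abs_le]; constructor <;> linarith [hs.1, hs.2]
    have h4 := abs_sub_abs_le_abs_sub (α s).2 v
    have h5 : B * |s - t| ≤ B * t := by gcongr
    linarith
  refine ⟨fun s => (α s).1, fun s => (α s).2, ?_, ?_, fun s hs => ?_, hV⟩
  · have : α t = (x, v) := hα0
    simp [this]
  · have : α t = (x, v) := hα0
    simp [this]
  · have h1 : HasDerivWithinAt (fun s => (α s).1) (clip (α s).2) (Icc 0 t) s := (hα s hs).fst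
    have h2 := abs_le.1 (hVbound s hs)
    have h3 : clip (α s).2 = (α s).2 := by simp [hclip, h2.1, h2.2]
    rwa [h3] at h1

/-- `(X, V)` solves `X' = V`, `V' = -γ` on `[0, t]`, where `γ` is a continuous acceleration. -/
structure IsTrajectory (t : ℝ) (γ X V : ℝ → ℝ) : Prop where
  continuousOn : ContinuousOn γ (Icc 0 t)
  position : ∀ s ∈ Icc 0 t, HasDerivWithinAt X (V s) (Icc 0 t) s
  velocity : ∀ s ∈ Icc 0 t, HasDerivWithinAt V (-γ s) (Icc 0 t) s

/-- The fundamental theorem of calculus for a `C¹` function on a closed interval. -/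
lemma integral_eq_sub_of_hasDerivWithinAt_Icc {t s : ℝ} {φ φ' : ℝ → ℝ}
    (h : ∀ r ∈ Icc 0 t, HasDerivWithinAt φ (φ' r) (Icc 0 t) r) (hc : ContinuousOn φ' (Icc 0 t))
    (hs : s ∈ Icc 0 t) : ∫ r in s..t, φ' r = φ t - φ s := by
  have hsub : Icc s t ⊆ Icc 0 t := Icc_subset_Icc_left hs.1
  refine intervalIntegral.integral_eq_sub_of_hasDerivAt_of_le hs.2
    (fun r hr => ((h r (hsub hr)).continuousWithinAt).mono hsub)
    (fun r hr => (h r (hsub (Ioo_subset_Icc_self hr))).hasDerivAt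
      (Icc_mem_nhds (hs.1.trans_lt hr.1) hr.2)) ?_
  rw [← uIcc_of_le hs.2] at hsub
  exact (hc.mono hsub).intervalIntegrable

namespace IsTrajectory

variable {t : ℝ} {γ X V b : ℝ → ℝ}

lemma continuousOn_velocity (h : IsTrajectory t γ X V) : ContinuousOn V (Icc 0 t) :=
  fun s hs => (h.velocity s hs).continuousWithinAt

lemma continuousOn_position (h : IsTrajectory t γ X V) : ContinuousOn X (Icc 0 t) :=
  fun s hs => (h.position s hs).continuousWithinAt

lemma velocity_eq (h : IsTrajectory t γ X V) {s : ℝ} (hs : s ∈ Icc 0 t) :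
    V s = V t + ∫ r in s..t, γ r := by
  have := integral_eq_sub_of_hasDerivWithinAt_Icc h.velocity h.continuousOn.neg hs
  rw [intervalIntegral.integral_neg] at this
  linarith

lemma position_eq (h : IsTrajectory t γ X V) {s : ℝ} (hs : s ∈ Icc 0 t) :
    X s = X t - ∫ r in s..t, V r := by
  have := integral_eq_sub_of_hasDerivWithinAt_Icc h.position h.continuousOn_velocity hs
  linarith

lemma abs_velocity_sub_le (h : IsTrajectory t γ X V) (hb : IntervalIntegrable b volume 0 t)
    (hγ : ∀ s ∈ Icc 0 t, |γ s| ≤ b s) {s : ℝ} (hs : s ∈ Icc 0 t) :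
    |V s - V t| ≤ ∫ r in s..t, b r := by
  rw [h.velocity_eq hs, add_sub_cancel_left, ← Real.norm_eq_abs]
  refine intervalIntegral.norm_integral_le_of_norm_le hs.2
    (Eventually.of_forall fun r hr => hγ r ⟨hs.1.trans hr.1.le, hr.2⟩)
    (hb.mono_set ?_)
  rw [uIcc_of_le hs.2, uIcc_of_le (hs.1.trans hs.2)]
  exact Icc_subset_Icc_left hs.1

lemma continuousOn_tail_integral (hb : IntervalIntegrable b volume 0 t) (ht : 0 ≤ t) :
    ContinuousOn (fun s => ∫ r in s..t, b r) (Icc 0 t) := by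
  have h1 : ContinuousOn (fun s => ∫ r in t..s, b r) (uIcc 0 t) :=
    intervalIntegral.continuousOn_primitive_interval' hb right_mem_uIcc
  rw [uIcc_of_le ht] at h1
  exact h1.neg.congr fun s _ => intervalIntegral.integral_symm _ _

/-- Integrating the speed bound `|V t| + ∫ b` once more produces the double integral that appears in
`spatialRadius`. -/
lemma abs_position_sub_le (h : IsTrajectory t γ X V) (hb : IntervalIntegrable b volume 0 t)
    (hγ : ∀ s ∈ Icc 0 t, |γ s| ≤ b s) {s : ℝ} (hs : s ∈ Icc 0 t) :
    |X s - X t| ≤ (t - s) * |V t| + ∫ τ in s..t, ∫ r in τ..t, b r := by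
  have hsub : uIcc s t ⊆ Icc 0 t := by
    rw [uIcc_of_le hs.2]; exact Icc_subset_Icc_left hs.1
  have hi : IntervalIntegrable (fun τ => ∫ r in τ..t, b r) volume s t :=
    ((continuousOn_tail_integral hb (hs.1.trans hs.2)).mono hsub).intervalIntegrable
  rw [h.position_eq hs, sub_sub_cancel_left, abs_neg, ← Real.norm_eq_abs]
  refine (intervalIntegral.norm_integral_le_of_norm_le
    (g := fun τ => |V t| + ∫ r in τ..t, b r) hs.2
    (Eventually.of_forall fun r hr => ?_) (intervalIntegrable_const.add hi)).trans ?_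
  · have h1 := h.abs_velocity_sub_le hb hγ (s := r) ⟨hs.1.trans hr.1.le, hr.2⟩
    have h2 := abs_sub_abs_le_abs_sub (V r) (V t)
    rw [Real.norm_eq_abs]
    linarith
  · rw [intervalIntegral.integral_add intervalIntegrable_const hi,
      intervalIntegral.integral_const, smul_eq_mul]

end IsTrajectory

/-! ### Differentiating a solution along trajectories -/

/-- Projection of the time axis onto `[0, T]`. -/
noncomputable def clampTime (T s : ℝ) : ℝ := max 0 (min T s)

lemma continuous_clampTime (T : ℝ) : Continuous (clampTime T) := by
  unfold clampTime; fun_prop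

lemma clampTime_mem {T : ℝ} (hT : 0 ≤ T) (s : ℝ) : clampTime T s ∈ Icc 0 T :=
  ⟨le_max_left _ _, max_le hT (min_le_left _ _)⟩

lemma clampTime_of_mem {T s : ℝ} (hs : s ∈ Icc 0 T) : clampTime T s = s := by
  simp [clampTime, hs.1, hs.2]

/-- The derivative of `f` on `[0, T] × ℝ²` in the direction `e`, extended to all times. -/
noncomputable def partialDeriv (T : ℝ) (f : ℝ → ℝ → ℝ → ℝ) (e : ℝ × ℝ × ℝ) (s x v : ℝ) : ℝ :=
  fderivWithin ℝ (fun p : ℝ × ℝ × ℝ => f p.1 p.2.1 p.2.2) (Icc 0 T ×ˢ univ) (clampTime T s, x, v) e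

section Regularity

variable {T : ℝ} {f : ℝ → ℝ → ℝ → ℝ}

lemma continuous_clamped (hT : 0 < T)
    (hf : ContDiffOn ℝ 1 (fun p : ℝ × ℝ × ℝ => f p.1 p.2.1 p.2.2) (Icc 0 T ×ˢ univ)) :
    Continuous fun p : ℝ × ℝ × ℝ => f (clampTime T p.1) p.2.1 p.2.2 := by
  have := continuous_clampTime T
  exact hf.continuousOn.comp_continuous
    (f := fun p : ℝ × ℝ × ℝ => (clampTime T p.1, p.2)) (by fun_prop)
    fun p => ⟨clampTime_mem hT.le _, mem_univ _⟩

lemma uniqueDiffOn_slab (hT : 0 < T) : UniqueDiffOn ℝ (Icc 0 T ×ˢ (univ : Set (ℝ × ℝ))) :=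
  (uniqueDiffOn_Icc hT).prod uniqueDiffOn_univ

lemma continuous_partialDeriv (hT : 0 < T)
    (hf : ContDiffOn ℝ 1 (fun p : ℝ × ℝ × ℝ => f p.1 p.2.1 p.2.2) (Icc 0 T ×ˢ univ))
    (e : ℝ × ℝ × ℝ) :
    Continuous fun p : ℝ × ℝ × ℝ => partialDeriv T f e p.1 p.2.1 p.2.2 := by
  have := continuous_clampTime T
  have h1 := (hf.continuousOn_fderivWithin (uniqueDiffOn_slab hT) le_rfl).comp_continuous
    (f := fun p : ℝ × ℝ × ℝ => (clampTime T p.1, p.2)) (by fun_prop)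
    fun p => ⟨clampTime_mem hT.le _, mem_univ _⟩
  exact h1.clm_apply continuous_const

lemma hasFDerivWithinAt_slab
    (hf : ContDiffOn ℝ 1 (fun p : ℝ × ℝ × ℝ => f p.1 p.2.1 p.2.2) (Icc 0 T ×ˢ univ))
    {s : ℝ} (hs : s ∈ Icc 0 T) (x v : ℝ) :
    HasFDerivWithinAt (fun p : ℝ × ℝ × ℝ => f p.1 p.2.1 p.2.2)
      (fderivWithin ℝ (fun p : ℝ × ℝ × ℝ => f p.1 p.2.1 p.2.2) (Icc 0 T ×ˢ univ)
        (clampTime T s, x, v)) (Icc 0 T ×ˢ univ) (s, x, v) := by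
  rw [clampTime_of_mem hs]
  exact (hf.differentiableOn one_ne_zero _ ⟨hs, mem_univ _⟩).hasFDerivWithinAt

lemma hasDerivWithinAt_along
    (hf : ContDiffOn ℝ 1 (fun p : ℝ × ℝ × ℝ => f p.1 p.2.1 p.2.2) (Icc 0 T ×ˢ univ))
    {t s x' v' : ℝ} {X V : ℝ → ℝ} (htT : t ≤ T) (hs : s ∈ Icc 0 t)
    (hX : HasDerivWithinAt X x' (Icc 0 t) s) (hV : HasDerivWithinAt V v' (Icc 0 t) s) :
    HasDerivWithinAt (fun r => f r (X r) (V r))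
      (partialDeriv T f (1, 0, 0) s (X s) (V s) + x' * partialDeriv T f (0, 1, 0) s (X s) (V s)
        + v' * partialDeriv T f (0, 0, 1) s (X s) (V s)) (Icc 0 t) s := by
  have h := (hasFDerivWithinAt_slab hf ⟨hs.1, hs.2.trans htT⟩ (X s) (V s)).comp_hasDerivWithinAt
    (f := fun r => (r, X r, V r)) s ((hasDerivWithinAt_id s _).prodMk (hX.prodMk hV))
    (fun r hr => ⟨⟨hr.1, hr.2.trans htT⟩, mem_univ _⟩)
  convert! h using 1
  have : ((1 : ℝ), x', v') = (1, 0, 0) + x' • ((0 : ℝ), (1 : ℝ), (0 : ℝ)) +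
      v' • ((0 : ℝ), (0 : ℝ), (1 : ℝ)) := by simp
  rw [this, map_add, map_add, map_smul, map_smul]
  rfl

lemma hasDerivAt_position
    (hf : ContDiffOn ℝ 1 (fun p : ℝ × ℝ × ℝ => f p.1 p.2.1 p.2.2) (Icc 0 T ×ˢ univ))
    {s : ℝ} (hs : s ∈ Icc 0 T) (x v : ℝ) :
    HasDerivAt (fun y => f s y v) (partialDeriv T f (0, 1, 0) s x v) x :=
  (hasFDerivWithinAt_slab hf hs x v).comp_hasDerivAt (f := fun y => (s, y, v)) x
    ((hasDerivAt_const x s).prodMk ((hasDerivAt_id x).prodMk (hasDerivAt_const x v)))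
    (Eventually.of_forall fun _ => ⟨hs, mem_univ _⟩)

lemma hasDerivAt_velocity
    (hf : ContDiffOn ℝ 1 (fun p : ℝ × ℝ × ℝ => f p.1 p.2.1 p.2.2) (Icc 0 T ×ˢ univ))
    {s : ℝ} (hs : s ∈ Icc 0 T) (x v : ℝ) :
    HasDerivAt (fun w => f s x w) (partialDeriv T f (0, 0, 1) s x v) v :=
  (hasFDerivWithinAt_slab hf hs x v).comp_hasDerivAt (f := fun w => (s, x, w)) v
    ((hasDerivAt_const v s).prodMk ((hasDerivAt_const v x).prodMk (hasDerivAt_id v)))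
    (Eventually.of_forall fun _ => ⟨hs, mem_univ _⟩)

lemma hasDerivWithinAt_time
    (hf : ContDiffOn ℝ 1 (fun p : ℝ × ℝ × ℝ => f p.1 p.2.1 p.2.2) (Icc 0 T ×ˢ univ))
    {s : ℝ} (hs : s ∈ Icc 0 T) (x v : ℝ) :
    HasDerivWithinAt (fun r => f r x v) (partialDeriv T f (1, 0, 0) s x v) (Icc 0 T) s := by
  simpa using hasDerivWithinAt_along hf le_rfl hs (hasDerivWithinAt_const s (Icc 0 T) x)
    (hasDerivWithinAt_const s (Icc 0 T) v)

variable {F : ℝ → ℝ} {f₀ : ℝ → ℝ → ℝ}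

lemma IsC1Solution.vlasov_partialDeriv (hf : IsC1Solution T F f₀ f) (hT : 0 < T) {s : ℝ}
    (hs : s ∈ Icc 0 T) (x v : ℝ) :
    partialDeriv T f (1, 0, 0) s x v + v * partialDeriv T f (0, 1, 0) s x v
      - electricField F f s x * partialDeriv T f (0, 0, 1) s x v = 0 := by
  have h := hf.vlasov s hs x v
  rwa [(hasDerivWithinAt_time hf.contDiffOn hs x v).derivWithin (uniqueDiffOn_Icc hT s hs),
    (hasDerivAt_position hf.contDiffOn hs x v).deriv,
    (hasDerivAt_velocity hf.contDiffOn hs x v).deriv] at h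

/-- The variation of a solution along a trajectory. -/
lemma IsC1Solution.hasDerivWithinAt_trajectory (hf : IsC1Solution T F f₀ f) (hT : 0 < T) {t : ℝ}
    (htT : t ≤ T) {γ X V : ℝ → ℝ} (h : IsTrajectory t γ X V) {s : ℝ} (hs : s ∈ Icc 0 t) :
    HasDerivWithinAt (fun r => f r (X r) (V r))
      ((electricField F f s (X s) - γ s) * partialDeriv T f (0, 0, 1) s (X s) (V s))
      (Icc 0 t) s := by
  have h1 := hasDerivWithinAt_along hf.contDiffOn htT hs (h.position s hs) (h.velocity s hs)
  have h2 := hf.vlasov_partialDeriv hT ⟨hs.1, hs.2.trans htT⟩ (X s) (V s)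
  convert! h1 using 1
  linarith

/-- The trajectory need not be a characteristic: transport cancels all but the mismatch of
accelerations times the velocity derivative. -/
lemma IsC1Solution.abs_sub_le_of_trajectory (hf : IsC1Solution T F f₀ f) (hT : 0 < T) {t : ℝ}
    (ht : t ∈ Icc 0 T) {γ X V : ℝ → ℝ} (h : IsTrajectory t γ X V) {w : ℝ → ℝ} {C : ℝ}
    (hw : IntervalIntegrable w volume 0 t)
    (hγ : ∀ s ∈ Icc 0 t, |electricField F f s (X s) - γ s| ≤ w s)
    (hC : ∀ s ∈ Icc 0 t, |partialDeriv T f (0, 0, 1) s (X s) (V s)| ≤ C) :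
    |f t (X t) (V t) - f₀ (X 0) (V 0)| ≤ C * ∫ s in 0..t, w s := by
  -- The field itself is not known to be continuous in time here, but the Vlasov equation rewrites
  -- this product through the continuous partial derivatives of `f` and the continuous `γ`.
  have hcont : ContinuousOn (fun s =>
      (electricField F f s (X s) - γ s) * partialDeriv T f (0, 0, 1) s (X s) (V s)) (Icc 0 t) := by
    have hD (e : ℝ × ℝ × ℝ) : ContinuousOn (fun s => partialDeriv T f e s (X s) (V s)) (Icc 0 t) :=
      (continuous_partialDeriv hT hf.contDiffOn e).comp_continuousOn
        (continuousOn_id.prodMk (h.continuousOn_position.prodMk h.continuousOn_velocity))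
    refine (((hD (1, 0, 0)).add (h.continuousOn_velocity.mul (hD (0, 1, 0)))).sub
      (h.continuousOn.mul (hD (0, 0, 1)))).congr fun s hs => ?_
    have h2 := hf.vlasov_partialDeriv hT ⟨hs.1, hs.2.trans ht.2⟩ (X s) (V s)
    simp only [Pi.add_apply, Pi.mul_apply, Pi.sub_apply]
    linarith
  have hftc := integral_eq_sub_of_hasDerivWithinAt_Icc
    (fun s hs => hf.hasDerivWithinAt_trajectory hT ht.2 h hs) hcont ⟨le_rfl, ht.1⟩
  rw [← hf.initial, ← hftc, ← Real.norm_eq_abs, ← intervalIntegral.integral_const_mul]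
  refine intervalIntegral.norm_integral_le_of_norm_le ht.1
    (Eventually.of_forall fun s hs => ?_) (hw.const_mul C)
  have hs' := Ioc_subset_Icc_self hs
  rw [Real.norm_eq_abs, abs_mul, mul_comm]
  exact mul_le_mul (hC s hs') (hγ s hs') (abs_nonneg _) ((abs_nonneg _).trans (hC s hs'))

end Regularity

/-! ### Basic properties of the field and compact velocity support -/

section Field

variable {T R : ℝ} {F : ℝ → ℝ} {f₀ : ℝ → ℝ → ℝ} {f : ℝ → ℝ → ℝ → ℝ}

/-- Half of the total charge. -/
noncomputable def halfCharge (F : ℝ → ℝ) (f : ℝ → ℝ → ℝ → ℝ) (t : ℝ) : ℝ :=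
  (1 / 2) * ∫ y, chargeDensity F f t y

lemma electricField_eq {t : ℝ} (h : Integrable fun y => chargeDensity F f t y) (x : ℝ) :
    electricField F f t x = (∫ y in Iic x, chargeDensity F f t y) - halfCharge F f t := by
  unfold electricField halfCharge
  rw [← intervalIntegral.integral_Iic_add_Ioi (b := x) h.integrableOn h.integrableOn]
  ring

lemma electricField_sub {t : ℝ} (h : Integrable fun y => chargeDensity F f t y) (x y : ℝ) :
    electricField F f t x - electricField F f t y = ∫ z in y..x, chargeDensity F f t z := by
  rw [electricField_eq h, electricField_eq h,
    ← intervalIntegral.integral_Iic_sub_Iic h.integrableOn h.integrableOn]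
  ring

lemma bddAbove_abs_electricField {t : ℝ} (h : Integrable fun y => chargeDensity F f t y) :
    BddAbove (range fun x => |electricField F f t x|) := by
  refine ⟨(∫ y, |chargeDensity F f t y|) + |halfCharge F f t|, ?_⟩
  rintro _ ⟨x, rfl⟩
  dsimp only
  rw [electricField_eq h]
  refine (abs_sub _ _).trans (add_le_add ?_ le_rfl)
  exact (abs_integral_le_integral_abs).trans
    (setIntegral_le_integral h.abs (Eventually.of_forall fun _ => abs_nonneg _))

lemma abs_electricField_le {t : ℝ} (h : Integrable fun y => chargeDensity F f t y) (x : ℝ) :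
    |electricField F f t x| ≤ fieldSupNorm F f t :=
  le_ciSup (bddAbove_abs_electricField h) x

lemma fieldSupNorm_nonneg (F : ℝ → ℝ) (f : ℝ → ℝ → ℝ → ℝ) (t : ℝ) : 0 ≤ fieldSupNorm F f t :=
  Real.iSup_nonneg fun _ => abs_nonneg _

/-- No bound on the density is available yet; absolute continuity of the integral of an integrable
density is enough. -/
lemma uniformContinuous_electricField {t : ℝ} (h : Integrable fun y => chargeDensity F f t y) :
    UniformContinuous (electricField F f t) := by
  rw [Metric.uniformContinuous_iff]
  intro ε hε
  have hfin : ∫⁻ y, ‖chargeDensity F f t y‖ₑ ≠ ⊤ := h.hasFiniteIntegral.ne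
  obtain ⟨δ, hδ, hlt⟩ := exists_pos_setLIntegral_lt_of_measure_lt hfin
    (ENNReal.ofReal_pos.2 hε).ne'
  obtain ⟨d, hd0, hd⟩ : ∃ d : ℝ, 0 < d ∧ ENNReal.ofReal d ≤ δ := by
    rcases eq_or_ne δ ⊤ with rfl | hne
    · exact ⟨1, one_pos, le_top⟩
    · exact ⟨δ.toReal, ENNReal.toReal_pos hδ.ne' hne, ENNReal.ofReal_toReal_le⟩
  refine ⟨d, hd0, fun {x y} hxy => ?_⟩
  rw [Real.dist_eq] at hxy ⊢
  rw [electricField_sub h]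
  have h1 : volume (uIoc y x) < δ := by
    rw [uIoc, Real.volume_Ioc, max_sub_min_eq_abs]
    exact ((ENNReal.ofReal_lt_ofReal_iff hd0).2 hxy).trans_le hd
  have h2 := hlt _ h1
  have h3 : ‖∫ z in y..x, chargeDensity F f t z‖ₑ ≤ ∫⁻ z in uIoc y x, ‖chargeDensity F f t z‖ₑ := by
    rw [← ofReal_norm, intervalIntegral.norm_intervalIntegral_eq, ofReal_norm]
    exact enorm_integral_le_lintegral_enorm _
  have h4 := h3.trans_lt h2
  rw [← ofReal_norm, ENNReal.ofReal_lt_ofReal_iff hε] at h4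
  exact h4

/-- Measurability survives iterated integration over unbounded domains, where continuity in time
could be lost. -/
lemma IsC1Solution.measurable_electricField (hf : IsC1Solution T F f₀ f) (hT : 0 < T)
    (hF : Continuous F) (x : ℝ) : Measurable fun s => electricField F f (clampTime T s) x := by
  have hc := continuous_clamped hT hf.contDiffOn
  have h1 : StronglyMeasurable fun q : (ℝ × ℝ) × ℝ => F q.2 - f (clampTime T q.1.1) q.1.2 q.2 := by
    refine Continuous.stronglyMeasurable ((by fun_prop : Continuous fun q : (ℝ × ℝ) × ℝ => F q.2).sub ?_)
    exact hc.comp (by fun_prop : Continuous fun q : (ℝ × ℝ) × ℝ => (q.1.1, q.1.2, q.2))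
  have h2 : StronglyMeasurable fun q : ℝ × ℝ => chargeDensity F f (clampTime T q.1) q.2 :=
    h1.integral_prod_right'
  have h3 (S : Set ℝ) : StronglyMeasurable
      fun s => ∫ y in S, chargeDensity F f (clampTime T s) y :=
    h2.integral_prod_right'
  exact (((h3 (Iic x)).sub (h3 (Ioi x))).const_mul (1 / 2)).measurable

/-- Approximate backward characteristics: every value of a solution is approximated by a value of
the initial datum at a velocity that differs by at most the total impulse of the field. -/
lemma IsC1Solution.exists_initial_near (hf : IsC1Solution T F f₀ f) (hT : 0 < T)
    (hF : Continuous F) (he : IntervalIntegrable (fieldSupNorm F f) volume 0 T) {t : ℝ}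
    (ht : t ∈ Icc 0 T) (x v : ℝ) {ε : ℝ} (hε : 0 < ε) :
    ∃ x' v', |v' - v| ≤ (∫ s in 0..T, fieldSupNorm F f s) + 1 ∧ |f t x v - f₀ x' v'| ≤ ε := by
  set Φ : ℝ := ∫ s in 0..T, fieldSupNorm F f s with hΦ
  have hΦ0 : 0 ≤ Φ := intervalIntegral.integral_nonneg hT.le fun s _ => fieldSupNorm_nonneg F f s
  -- `N` and `K` bound the velocity and position of every approximate trajectory in advance, so that
  -- `∂_v f` can be bounded on a box before the approximation is chosen.
  set N : ℝ := |v| + (Φ + 1) with hN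
  have hN0 : 0 < N := by positivity
  set K : ℝ := |x| + T * N with hK
  have hK0 : 0 < K := by positivity
  have hcomp : IsCompact (Icc 0 T ×ˢ Icc (-K) K ×ˢ Icc (-N) N) :=
    isCompact_Icc.prod (isCompact_Icc.prod isCompact_Icc)
  obtain ⟨C, hC⟩ := hcomp.exists_bound_of_continuousOn
    (continuous_partialDeriv hT hf.contDiffOn (0, 0, 1)).continuousOn
  set C' : ℝ := max C 1 with hC'
  have hC'0 : 0 < C' := lt_of_lt_of_le one_pos (le_max_right _ _)
  obtain ⟨G, hGc, ⟨L, hGL⟩, ⟨B, hGB⟩, w, hwi, hwε, hwG⟩ :=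
    exists_lipschitz_approx (E := fun s => electricField F f (clampTime T s)) hT.le hK0 he
      (hf.measurable_electricField hT hF)
      (fun s hs y => by
        rw [clampTime_of_mem hs]; exact abs_electricField_le (hf.integrable_density s hs) y)
      (fun s hs => uniformContinuous_electricField
        (hf.integrable_density _ (clampTime_mem hT.le s)))
      -- The 1 caps the excess impulse of `G`; `ε / C'` caps the drift of `f` along the trajectory.
      (ε := min 1 (ε / C')) (by positivity)
  obtain ⟨X, V, hXt, hVt, hX, hV⟩ := exists_trajectory ht.1 (fun y => (hGc y).continuousOn)
    (fun s _ => hGL s) (fun s _ => hGB s) x v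
  have hXc : ContinuousOn X (Icc 0 t) := fun s hs => (hX s hs).continuousWithinAt
  have hGcont : Continuous fun p : ℝ × ℝ => G p.1 p.2 :=
    continuous_prod_of_continuous_lipschitzWith' (fun p : ℝ × ℝ => G p.1 p.2) L
      (fun s => hGL s) (fun y => hGc y)
  have htraj : IsTrajectory t (fun s => G s (X s)) X V :=
    ⟨hGcont.comp_continuousOn (continuousOn_id.prodMk hXc), hX, hV⟩
  have hsubset : uIcc 0 t ⊆ uIcc 0 T := by
    rw [uIcc_of_le ht.1, uIcc_of_le hT.le]; exact Icc_subset_Icc_right ht.2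
  have hbi : IntervalIntegrable (fun s => fieldSupNorm F f s + w s) volume 0 T := he.add hwi
  have hw0 : ∀ s ∈ Icc 0 T, 0 ≤ w s := fun s hs =>
    (abs_nonneg _).trans ((hwG s hs).1 0 (by simpa using hK0.le))
  have hb0 : ∀ s ∈ Icc 0 T, 0 ≤ fieldSupNorm F f s + w s := fun s hs =>
    add_nonneg (fieldSupNorm_nonneg F f s) (hw0 s hs)
  have hmono : ∀ {u : ℝ → ℝ}, IntervalIntegrable u volume 0 T → (∀ s ∈ Icc 0 T, 0 ≤ u s) →
      ∀ s ∈ Icc 0 t, ∫ r in s..t, u r ≤ ∫ r in 0..T, u r := by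
    intro u hu hu0 s hs
    refine intervalIntegral.integral_mono_interval hs.1 hs.2 ht.2 ?_ hu
    filter_upwards [ae_restrict_mem measurableSet_Ioc] with r hr
    exact hu0 r (Ioc_subset_Icc_self hr)
  have hΦ1 : ∫ r in 0..T, (fieldSupNorm F f r + w r) ≤ Φ + 1 := by
    rw [intervalIntegral.integral_add he hwi]
    linarith [min_le_left 1 (ε / C')]
  -- This uses the global bound on `G`, not the approximation on `[-K, K]`, so there is no
  -- circularity with the position bound derived from it below.
  have hVb : ∀ s ∈ Icc 0 t, |V s - v| ≤ Φ + 1 := fun s hs => by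
    rw [← hVt]
    exact ((htraj.abs_velocity_sub_le (hbi.mono_set hsubset)
      (fun r hr => (hwG r ⟨hr.1, hr.2.trans ht.2⟩).2 _) hs).trans (hmono hbi hb0 s hs)).trans hΦ1
  have hVN : ∀ s ∈ Icc 0 t, |V s| ≤ N := fun s hs => by
    have := abs_sub_abs_le_abs_sub (V s) v
    linarith [hVb s hs]
  have hXK : ∀ s ∈ Icc 0 t, |X s| ≤ K := by
    intro s hs
    have h1 := Convex.norm_image_sub_le_of_norm_hasDerivWithin_le (C := N) hX
      (fun r hr => hVN r hr) (convex_Icc 0 t) (⟨ht.1, le_rfl⟩ : t ∈ Icc 0 t) hs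
    rw [hXt, Real.norm_eq_abs, Real.norm_eq_abs] at h1
    have h3 : |s - t| ≤ T := by rw [abs_le]; constructor <;> linarith [hs.1, hs.2, ht.2]
    have h4 := abs_sub_abs_le_abs_sub (X s) x
    have h5 : N * |s - t| ≤ N * T := by gcongr
    linarith
  refine ⟨X 0, V 0, hVb 0 ⟨le_rfl, ht.1⟩, ?_⟩
  have hmain := hf.abs_sub_le_of_trajectory hT ht htraj (hwi.mono_set hsubset) (C := C')
    (fun s hs => by
      have hs' : s ∈ Icc 0 T := ⟨hs.1, hs.2.trans ht.2⟩
      have := (hwG s hs').1 (X s) (hXK s hs)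
      rwa [clampTime_of_mem hs'] at this)
    (fun s hs => (hC (s, X s, V s) ⟨⟨hs.1, hs.2.trans ht.2⟩, abs_le.1 (hXK s hs),
      abs_le.1 (hVN s hs)⟩).trans (le_max_left _ _))
  rw [hXt, hVt] at hmain
  calc _ ≤ C' * ∫ s in 0..t, w s := hmain
    _ ≤ C' * (ε / C') := by
        gcongr
        exact ((hmono hwi hw0 0 ⟨le_rfl, ht.1⟩).trans hwε).trans (min_le_right _ _)
    _ = ε := by field_simp

lemma IsAdmissibleData.exists_bound (h : IsAdmissibleData R F f₀) :
    ∃ B P : ℝ, 0 < P ∧ (∀ x v, |f₀ x v| ≤ B) ∧ (∀ v, |F v| ≤ B) ∧ (∀ x v, P < |v| → f₀ x v = 0) ∧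
      ∀ v, P < |v| → F v = 0 := by
  obtain ⟨P₁, hP₁⟩ := h.initial_velocity_support
  set P : ℝ := max P₁ 1 with hP
  -- The background inherits the velocity support of `f₀` at a point outside `[-R, R]`.
  have hFP : ∀ v, P < |v| → F v = 0 := fun v hv => by
    rw [← h.initial_eq_background (R + 1) v (lt_of_lt_of_le (by linarith) (le_abs_self _))]
    exact hP₁ _ _ ((le_max_left _ _).trans_lt hv)
  obtain ⟨B₁, hB₁⟩ := h.background_hasCompactSupport.exists_bound_of_continuous
    h.background_contDiff.continuous
  obtain ⟨B₂, hB₂⟩ := (isCompact_Icc.prod isCompact_Icc : IsCompact (Icc (-R) R ×ˢ Icc (-P) P)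
    ).exists_bound_of_continuousOn h.initial_contDiff.continuous.continuousOn
  have hB₁0 : 0 ≤ B₁ := (norm_nonneg _).trans (hB₁ 0)
  refine ⟨max B₁ B₂, P, lt_of_lt_of_le one_pos (le_max_right _ _), fun x v => ?_,
    fun v => (hB₁ v).trans (le_max_left _ _),
    fun x v hv => hP₁ _ _ ((le_max_left _ _).trans_lt hv), hFP⟩
  by_cases hx : R < |x|
  · rw [h.initial_eq_background x v hx]
    exact (hB₁ v).trans (le_max_left _ _)
  by_cases hv : P < |v|
  · rw [hP₁ _ _ ((le_max_left _ _).trans_lt hv), abs_zero]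
    exact hB₁0.trans (le_max_left _ _)
  · exact (hB₂ (x, v) ⟨abs_le.1 (not_lt.1 hx), abs_le.1 (not_lt.1 hv)⟩).trans (le_max_right _ _)

/-- A solution is bounded and compactly supported in velocity, uniformly in time and position. -/
lemma IsC1Solution.exists_bound (hf : IsC1Solution T F f₀ f) (hT : 0 < T)
    (h : IsAdmissibleData R F f₀) (he : IntervalIntegrable (fieldSupNorm F f) volume 0 T) :
    ∃ B P : ℝ, 0 < P ∧ (∀ t ∈ Icc 0 T, ∀ x v, |f t x v| ≤ B) ∧ (∀ v, |F v| ≤ B) ∧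
      (∀ t ∈ Icc 0 T, ∀ x v, P ≤ |v| → f t x v = 0) ∧ ∀ v, P ≤ |v| → F v = 0 := by
  obtain ⟨B, P, hP, hB, hFB, hfP, hFP⟩ := h.exists_bound
  have hΦ0 : 0 ≤ ∫ s in 0..T, fieldSupNorm F f s :=
    intervalIntegral.integral_nonneg hT.le fun s _ => fieldSupNorm_nonneg F f s
  have hnear := fun t ht x v ε hε => hf.exists_initial_near hT
    h.background_contDiff.continuous he (t := t) ht x v (ε := ε) hε
  -- One unit covers the slack in `exists_initial_near`; the other makes the resulting initial speed
  -- strictly larger than `P`.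
  refine ⟨B, P + (∫ s in 0..T, fieldSupNorm F f s) + 2, by positivity, fun t ht x v => ?_, hFB,
    fun t ht x v hv => ?_, fun v hv => hFP v (by linarith)⟩
  · refine le_of_forall_pos_le_add fun ε hε => ?_
    obtain ⟨x', v', -, h2⟩ := hnear t ht x v ε hε
    linarith [hB x' v', abs_sub_abs_le_abs_sub (f t x v) (f₀ x' v')]
  · refine abs_eq_zero.1 (le_antisymm (le_of_forall_pos_le_add fun ε hε => ?_) (abs_nonneg _))
    obtain ⟨x', v', h1, h2⟩ := hnear t ht x v ε hε
    rw [hfP x' v' (by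
      have := abs_sub_abs_le_abs_sub v v'
      rw [abs_sub_comm] at this
      linarith), sub_zero] at h2
    linarith

end Field

/-! ### Balance of charge -/

/-- The solution and the background are bounded by `B` and vanish at speeds `≥ P`. -/
structure HasVelocityBound (T B P : ℝ) (F : ℝ → ℝ) (f : ℝ → ℝ → ℝ → ℝ) : Prop where
  pos : 0 < P
  abs_le : ∀ t ∈ Icc 0 T, ∀ x v, |f t x v| ≤ B
  background_abs_le : ∀ v, |F v| ≤ B
  eq_zero : ∀ t ∈ Icc 0 T, ∀ x v, P ≤ |v| → f t x v = 0
  background_eq_zero : ∀ v, P ≤ |v| → F v = 0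

/-- The momentum density `∫ v f(t,x,v) dv`. -/
noncomputable def momentum (f : ℝ → ℝ → ℝ → ℝ) (t x : ℝ) : ℝ := ∫ v, v * f t x v

lemma integral_swap_of_continuous {u : ℝ → ℝ → ℝ} (hu : Continuous fun p : ℝ × ℝ => u p.1 p.2)
    (a b c d : ℝ) :
    ∫ x in a..b, ∫ y in c..d, u x y = ∫ y in c..d, ∫ x in a..b, u x y := by
  refine intervalIntegral_intervalIntegral_swap ?_
  refine (hu.continuousOn.integrableOn_compact
    (isCompact_uIcc.prod isCompact_uIcc)).mono_set (prod_mono uIoc_subset_uIcc uIoc_subset_uIcc)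

lemma integral_eq_of_eq_zero {P : ℝ} {u : ℝ → ℝ} (hu : ∀ v, P ≤ |v| → u v = 0) :
    ∫ v, u v = ∫ v in -P..P, u v := by
  refine (intervalIntegral.integral_eq_integral_of_support_subset fun v hv => ?_).symm
  have : |v| < P := by
    by_contra h
    exact hv (hu v (not_lt.1 h))
  rw [abs_lt] at this
  exact ⟨this.1, this.2.le⟩

section Balance

variable {T B P : ℝ} {F : ℝ → ℝ} {f₀ : ℝ → ℝ → ℝ} {f : ℝ → ℝ → ℝ → ℝ}

lemma HasVelocityBound.chargeDensity_eq (hb : HasVelocityBound T B P F f) {t : ℝ}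
    (ht : t ∈ Icc 0 T) (x : ℝ) : chargeDensity F f t x = ∫ v in -P..P, (F v - f t x v) :=
  integral_eq_of_eq_zero fun v hv => by
    rw [hb.background_eq_zero v hv, hb.eq_zero t ht x v hv, sub_zero]

lemma HasVelocityBound.momentum_eq (hb : HasVelocityBound T B P F f) {t : ℝ}
    (ht : t ∈ Icc 0 T) (x : ℝ) : momentum f t x = ∫ v in -P..P, v * f t x v :=
  integral_eq_of_eq_zero fun v hv => by rw [hb.eq_zero t ht x v hv, mul_zero]

lemma HasVelocityBound.abs_chargeDensity_le (hb : HasVelocityBound T B P F f) {t : ℝ}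
    (ht : t ∈ Icc 0 T) (x : ℝ) : |chargeDensity F f t x| ≤ 4 * B * P := by
  rw [hb.chargeDensity_eq ht]
  have := intervalIntegral.norm_integral_le_of_norm_le_const (a := -P) (b := P) (C := 2 * B)
    (f := fun v => F v - f t x v)
    fun v _ => (abs_sub _ _).trans (by linarith [hb.background_abs_le v, hb.abs_le t ht x v])
  rw [sub_neg_eq_add, abs_of_pos (by linarith [hb.pos])] at this
  calc _ ≤ _ := this
    _ = _ := by ring

lemma HasVelocityBound.abs_momentum_le (hb : HasVelocityBound T B P F f) {t : ℝ}
    (ht : t ∈ Icc 0 T) (x : ℝ) : |momentum f t x| ≤ 2 * B * P ^ 2 := by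
  rw [hb.momentum_eq ht]
  have := intervalIntegral.norm_integral_le_of_norm_le_const (a := -P) (b := P) (C := P * B)
    (f := fun v => v * f t x v) fun v hv => by
      rw [uIoc_of_le (by linarith [hb.pos])] at hv
      rw [norm_mul]
      exact mul_le_mul (_root_.abs_le.2 ⟨hv.1.le, hv.2⟩) (hb.abs_le t ht x v) (abs_nonneg _) hb.pos.le
  rw [sub_neg_eq_add, abs_of_pos (by linarith [hb.pos])] at this
  calc _ ≤ _ := this
    _ = _ := by ring

lemma IsC1Solution.continuous_slice (hf : IsC1Solution T F f₀ f) (hT : 0 < T) {t : ℝ}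
    (ht : t ∈ Icc 0 T) : Continuous fun p : ℝ × ℝ => f t p.1 p.2 := by
  have h := (continuous_clamped hT hf.contDiffOn).comp
    (by fun_prop : Continuous fun p : ℝ × ℝ => (t, p.1, p.2))
  simpa [Function.comp_def, clampTime_of_mem ht] using h

lemma IsC1Solution.continuous_chargeDensity (hf : IsC1Solution T F f₀ f) (hT : 0 < T)
    (hF : Continuous F) (hb : HasVelocityBound T B P F f) :
    Continuous fun q : ℝ × ℝ => chargeDensity F f (clampTime T q.1) q.2 := by
  have hc := (continuous_clamped hT hf.contDiffOn).comp
    (by fun_prop : Continuous fun q : (ℝ × ℝ) × ℝ => (q.1.1, q.1.2, q.2))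
  have h1 : Continuous (Function.uncurry fun (q : ℝ × ℝ) (v : ℝ) =>
      F v - f (clampTime T q.1) q.2 v) := (hF.comp continuous_snd).sub hc
  simpa only [hb.chargeDensity_eq (clampTime_mem hT.le _)] using
    intervalIntegral.continuous_parametric_intervalIntegral_of_continuous' (μ := volume) h1 (-P) P

lemma IsC1Solution.continuous_momentum (hf : IsC1Solution T F f₀ f) (hT : 0 < T)
    (hb : HasVelocityBound T B P F f) :
    Continuous fun q : ℝ × ℝ => momentum f (clampTime T q.1) q.2 := by
  have hc := (continuous_clamped hT hf.contDiffOn).comp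
    (by fun_prop : Continuous fun q : (ℝ × ℝ) × ℝ => (q.1.1, q.1.2, q.2))
  have h1 : Continuous (Function.uncurry fun (q : ℝ × ℝ) (v : ℝ) =>
      v * f (clampTime T q.1) q.2 v) := continuous_snd.mul hc
  simpa only [hb.momentum_eq (clampTime_mem hT.le _)] using
    intervalIntegral.continuous_parametric_intervalIntegral_of_continuous' (μ := volume) h1 (-P) P

/-- In the velocity integral of the Vlasov equation the field term is a total derivative whose
boundary values at `±P` vanish. -/
lemma IsC1Solution.integral_time_partialDeriv (hf : IsC1Solution T F f₀ f) (hT : 0 < T)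
    (hb : HasVelocityBound T B P F f) {s : ℝ} (hs : s ∈ Icc 0 T) (x : ℝ) :
    ∫ v in -P..P, partialDeriv T f (1, 0, 0) s x v
      = - ∫ v in -P..P, v * partialDeriv T f (0, 1, 0) s x v := by
  have hD (e : ℝ × ℝ × ℝ) : Continuous fun v => partialDeriv T f e s x v :=
    (continuous_partialDeriv hT hf.contDiffOn e).comp
      (by fun_prop : Continuous fun v : ℝ => (s, x, v))
  have h0 : ∫ v in -P..P, partialDeriv T f (0, 0, 1) s x v = 0 := by
    rw [intervalIntegral.integral_eq_sub_of_hasDerivAt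
      (fun v _ => hasDerivAt_velocity hf.contDiffOn hs x v) ((hD _).intervalIntegrable _ _),
      hb.eq_zero s hs x P (le_abs_self P),
      hb.eq_zero s hs x (-P) (by rw [abs_neg]; exact le_abs_self P), sub_zero]
  have h1 : ∀ v, partialDeriv T f (1, 0, 0) s x v = electricField F f s x *
      partialDeriv T f (0, 0, 1) s x v - v * partialDeriv T f (0, 1, 0) s x v := fun v => by
    linarith [hf.vlasov_partialDeriv hT hs x v]
  simp_rw [h1]
  rw [intervalIntegral.integral_sub (((hD _).const_mul _).intervalIntegrable _ _)
    (Continuous.intervalIntegrable (by fun_prop) _ _), intervalIntegral.integral_const_mul, h0]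
  ring

/-- The balance of charge on a bounded interval. -/
lemma IsC1Solution.charge_balance (hf : IsC1Solution T F f₀ f) (hT : 0 < T) (hF : Continuous F)
    (hb : HasVelocityBound T B P F f) {t : ℝ} (ht : t ∈ Icc 0 T) (a b : ℝ) :
    (∫ y in a..b, chargeDensity F f t y) - ∫ y in a..b, chargeDensity F f 0 y
      = ∫ s in 0..t, (momentum f s b - momentum f s a) := by
  have h0 : (0 : ℝ) ∈ Icc 0 T := ⟨le_rfl, hT.le⟩
  have hDc (e : ℝ × ℝ × ℝ) := continuous_partialDeriv hT hf.contDiffOn e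
  have hsub : ∀ s ∈ uIcc 0 t, s ∈ Icc 0 T := fun s hs => by
    rw [uIcc_of_le ht.1] at hs; exact ⟨hs.1, hs.2.trans ht.2⟩
  have hslice : ∀ s ∈ Icc 0 T, ∀ y, Continuous fun v => f s y v := fun s hs y =>
    (hf.continuous_slice hT hs).comp (by fun_prop : Continuous fun v : ℝ => (y, v))
  have hρc : ∀ s ∈ Icc 0 T, Continuous fun y => chargeDensity F f s y := fun s hs => by
    have h := (hf.continuous_chargeDensity hT hF hb).comp
      (by fun_prop : Continuous fun y : ℝ => (s, y))
    simpa [Function.comp_def, clampTime_of_mem hs] using h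
  -- The balance is obtained in integrated form, by the fundamental theorem of calculus and Fubini,
  -- which avoids differentiating under the integral sign.
  have hρ (y : ℝ) : chargeDensity F f t y - chargeDensity F f 0 y
      = ∫ s in 0..t, ∫ v in -P..P, v * partialDeriv T f (0, 1, 0) s y v := by
    have ht' := hslice t ht y
    have h0' := hslice 0 h0 y
    rw [hb.chargeDensity_eq ht, hb.chargeDensity_eq h0, ← intervalIntegral.integral_sub
      (Continuous.intervalIntegrable (by fun_prop) _ _)
      (Continuous.intervalIntegrable (by fun_prop) _ _)]
    have h1 (v : ℝ) : F v - f t y v - (F v - f 0 y v)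
        = - ∫ s in 0..t, partialDeriv T f (1, 0, 0) s y v := by
      rw [integral_eq_sub_of_hasDerivWithinAt_Icc (φ := fun s => f s y v)
        (fun s hs => (hasDerivWithinAt_time hf.contDiffOn ⟨hs.1, hs.2.trans ht.2⟩ y v).mono
          (Icc_subset_Icc_right ht.2))
        ((hDc (1, 0, 0)).comp (by fun_prop : Continuous fun s : ℝ => (s, y, v))).continuousOn
        ⟨le_rfl, ht.1⟩]
      ring
    simp_rw [h1]
    rw [intervalIntegral.integral_neg, integral_swap_of_continuous
      ((hDc (1, 0, 0)).comp (by fun_prop : Continuous fun p : ℝ × ℝ => (p.2, y, p.1))),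
      ← intervalIntegral.integral_neg]
    refine intervalIntegral.integral_congr fun s hs => ?_
    rw [hf.integral_time_partialDeriv hT hb (hsub s hs), neg_neg]
  rw [← intervalIntegral.integral_sub ((hρc t ht).intervalIntegrable _ _)
    ((hρc 0 h0).intervalIntegrable _ _)]
  simp_rw [hρ]
  have hc3 : Continuous (Function.uncurry fun (p : ℝ × ℝ) (v : ℝ) =>
      v * partialDeriv T f (0, 1, 0) p.2 p.1 v) :=
    continuous_snd.mul ((hDc (0, 1, 0)).comp
      (by fun_prop : Continuous fun q : (ℝ × ℝ) × ℝ => (q.1.2, q.1.1, q.2)))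
  rw [integral_swap_of_continuous
    (intervalIntegral.continuous_parametric_intervalIntegral_of_continuous' hc3 (-P) P)]
  refine intervalIntegral.integral_congr fun s hs => ?_
  have hs' := hsub s hs
  have hb' := hslice s hs' b
  have ha' := hslice s hs' a
  rw [hb.momentum_eq hs', hb.momentum_eq hs', ← intervalIntegral.integral_sub
    (Continuous.intervalIntegrable (by fun_prop) _ _)
    (Continuous.intervalIntegrable (by fun_prop) _ _),
    integral_swap_of_continuous (hc3.comp
      (by fun_prop : Continuous fun p : ℝ × ℝ => ((p.1, s), p.2)))]
  refine intervalIntegral.integral_congr fun v _ => ?_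
  rw [intervalIntegral.integral_const_mul, intervalIntegral.integral_eq_sub_of_hasDerivAt
    (fun y _ => hasDerivAt_position hf.contDiffOn hs' y v)
    (((hDc (0, 1, 0)).comp
      (by fun_prop : Continuous fun y : ℝ => (s, y, v))).intervalIntegrable _ _)]
  ring

end Balance

/-! ### Regularity of the field and exact characteristics -/

section Characteristics

variable {T B P : ℝ} {F : ℝ → ℝ} {f₀ : ℝ → ℝ → ℝ} {f : ℝ → ℝ → ℝ → ℝ}

lemma electricField_eq_sub_integral_Ioi {t : ℝ} (h : Integrable fun y => chargeDensity F f t y)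
    (x : ℝ) :
    electricField F f t x = halfCharge F f t - ∫ y in Ioi x, chargeDensity F f t y := by
  unfold electricField halfCharge
  rw [← intervalIntegral.integral_Iic_add_Ioi (b := x) h.integrableOn h.integrableOn]
  ring

/-- The field at spatial infinity. -/
lemma tendsto_electricField {t σ : ℝ} (hσ : σ = 1 ∨ σ = -1)
    (h : Integrable fun y => chargeDensity F f t y) :
    Tendsto (fun y => electricField F f t (σ * y)) atTop (𝓝 (σ * halfCharge F f t)) := by
  have htot : ∫ y, chargeDensity F f t y = 2 * halfCharge F f t := by unfold halfCharge; ring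
  rcases hσ with rfl | rfl
  · have h1 := (aecover_Iic (μ := volume) (tendsto_id (α := ℝ) (x := atTop))
      ).integral_tendsto_of_countably_generated h
    rw [htot] at h1
    have h2 := h1.sub_const (halfCharge F f t)
    rw [show 2 * halfCharge F f t - halfCharge F f t = 1 * halfCharge F f t by ring] at h2
    simpa only [one_mul, electricField_eq h, id] using h2
  · have h1 := (aecover_Ioi (μ := volume)
      (tendsto_neg_atTop_atBot : Tendsto (fun y : ℝ => -y) atTop atBot)).integral_tendsto_of_countably_generated h
    rw [htot] at h1
    have h2 := h1.const_sub (halfCharge F f t)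
    rw [show halfCharge F f t - 2 * halfCharge F f t = -1 * halfCharge F f t by ring] at h2
    simpa only [neg_one_mul, electricField_eq_sub_integral_Ioi h] using h2

lemma IsC1Solution.continuousOn_momentum (hf : IsC1Solution T F f₀ f) (hT : 0 < T)
    (hb : HasVelocityBound T B P F f) (x : ℝ) : ContinuousOn (fun s => momentum f s x) (Icc 0 T) := by
  have h := (hf.continuous_momentum hT hb).comp (by fun_prop : Continuous fun s : ℝ => (s, x))
  refine h.continuousOn.congr fun s hs => ?_
  simp [clampTime_of_mem hs]

lemma IsC1Solution.intervalIntegrable_momentum (hf : IsC1Solution T F f₀ f) (hT : 0 < T)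
    (hb : HasVelocityBound T B P F f) (x : ℝ) {r t : ℝ} (hr : r ∈ Icc 0 T) (ht : t ∈ Icc 0 T) :
    IntervalIntegrable (fun s => momentum f s x) volume r t :=
  ((hf.continuousOn_momentum hT hb x).mono
    (by rw [← uIcc_of_le hT.le] at hr ht ⊢; exact uIcc_subset_uIcc hr ht)).intervalIntegrable

/-- The change of the field in time, as a limit of fluxes. -/
lemma IsC1Solution.tendsto_field_balance (hf : IsC1Solution T F f₀ f) (hT : 0 < T)
    (hF : Continuous F) (hb : HasVelocityBound T B P F f) {r t : ℝ} (hr : r ∈ Icc 0 T)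
    (ht : t ∈ Icc 0 T) (x : ℝ) :
    Tendsto (fun L => ∫ s in r..t, (momentum f s x - (momentum f s L + momentum f s (-L)) / 2))
      atTop (𝓝 (electricField F f t x - electricField F f r x)) := by
  -- Truncating both integrals at `±L` leaves bounded intervals, to which the charge balance
  -- applies.
  have hlim : ∀ s ∈ Icc 0 T, Tendsto (fun L => (1 / 2) * ((∫ y in -L..x, chargeDensity F f s y)
      - ∫ y in x..L, chargeDensity F f s y)) atTop (𝓝 (electricField F f s x)) := fun s hs =>
    ((intervalIntegral_tendsto_integral_Iic x (hf.integrable_density s hs).integrableOn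
      tendsto_neg_atTop_atBot).sub (intervalIntegral_tendsto_integral_Ioi x
        (hf.integrable_density s hs).integrableOn tendsto_id)).const_mul _
  refine ((hlim t ht).sub (hlim r hr)).congr fun L => ?_
  have hbal : ∀ a b, (∫ y in a..b, chargeDensity F f t y) - ∫ y in a..b, chargeDensity F f r y
      = (∫ s in r..t, momentum f s b) - ∫ s in r..t, momentum f s a := by
    intro a b
    have h0 : (0 : ℝ) ∈ Icc 0 T := ⟨le_rfl, hT.le⟩
    have h1 := hf.charge_balance hT hF hb ht a b
    have h2 := hf.charge_balance hT hF hb hr a b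
    have hi := fun y => hf.intervalIntegrable_momentum hT hb y h0 ht
    have hi' := fun y => hf.intervalIntegrable_momentum hT hb y h0 hr
    rw [intervalIntegral.integral_sub (hi b) (hi a)] at h1
    rw [intervalIntegral.integral_sub (hi' b) (hi' a)] at h2
    have h3 := intervalIntegral.integral_interval_sub_left (hi a) (hi' a)
    have h4 := intervalIntegral.integral_interval_sub_left (hi b) (hi' b)
    linarith
  have hi := fun y => hf.intervalIntegrable_momentum hT hb y hr ht
  rw [intervalIntegral.integral_sub (hi x) (((hi L).add (hi (-L))).div_const 2),
    intervalIntegral.integral_div, intervalIntegral.integral_add (hi L) (hi (-L))]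
  have h1 := hbal (-L) x
  have h2 := hbal x L
  linarith

/-- The fluxes are bounded uniformly in the truncation, so the bound passes to the limit without
knowing the momentum at infinity. -/
lemma IsC1Solution.abs_electricField_time_sub_le (hf : IsC1Solution T F f₀ f) (hT : 0 < T)
    (hF : Continuous F) (hb : HasVelocityBound T B P F f) {r t : ℝ} (hr : r ∈ Icc 0 T)
    (ht : t ∈ Icc 0 T) (x : ℝ) :
    |electricField F f t x - electricField F f r x| ≤ 4 * B * P ^ 2 * |t - r| := by
  refine le_of_tendsto (hf.tendsto_field_balance hT hF hb hr ht x).abs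
    (Eventually.of_forall fun L => ?_)
  rw [← Real.norm_eq_abs]
  refine intervalIntegral.norm_integral_le_of_norm_le_const fun s hs => ?_
  have hs' : s ∈ Icc 0 T := by
    rw [← uIcc_of_le hT.le] at hr ht ⊢
    exact uIcc_subset_uIcc hr ht (uIoc_subset_uIcc hs)
  have h1 := abs_le.1 (hb.abs_momentum_le hs' x)
  have h2 := abs_le.1 (hb.abs_momentum_le hs' L)
  have h3 := abs_le.1 (hb.abs_momentum_le hs' (-L))
  rw [Real.norm_eq_abs, abs_le]
  constructor <;> linarith

lemma HasVelocityBound.bound_nonneg (hb : HasVelocityBound T B P F f) : 0 ≤ B :=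
  (abs_nonneg _).trans (hb.background_abs_le 0)

lemma IsC1Solution.lipschitzWith_electricField (hf : IsC1Solution T F f₀ f)
    (hb : HasVelocityBound T B P F f) {t : ℝ} (ht : t ∈ Icc 0 T) :
    LipschitzWith (Real.toNNReal (4 * B * P)) (electricField F f t) := by
  refine LipschitzWith.of_dist_le_mul fun x y => ?_
  have hB := hb.bound_nonneg
  have hP := hb.pos
  rw [Real.coe_toNNReal _ (by positivity), Real.dist_eq, Real.dist_eq,
    electricField_sub (hf.integrable_density t ht), ← Real.norm_eq_abs]
  exact intervalIntegral.norm_integral_le_of_norm_le_const fun z _ => hb.abs_chargeDensity_le ht z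

lemma IsC1Solution.continuousOn_electricField_time (hf : IsC1Solution T F f₀ f) (hT : 0 < T)
    (hF : Continuous F) (hb : HasVelocityBound T B P F f) (x : ℝ) :
    ContinuousOn (fun s => electricField F f s x) (Icc 0 T) := by
  have hB := hb.bound_nonneg
  refine LipschitzOnWith.continuousOn (K := Real.toNNReal (4 * B * P ^ 2))
    (LipschitzOnWith.of_dist_le_mul fun t ht r hr => ?_)
  rw [Real.coe_toNNReal _ (by positivity), Real.dist_eq, Real.dist_eq]
  exact hf.abs_electricField_time_sub_le hT hF hb hr ht x

lemma IsC1Solution.exists_field_bound (hf : IsC1Solution T F f₀ f) (hT : 0 < T)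
    (hF : Continuous F) (hb : HasVelocityBound T B P F f) :
    ∃ C, ∀ s ∈ Icc 0 T, ∀ x, |electricField F f s x| ≤ C := by
  have h0 : (0 : ℝ) ∈ Icc 0 T := ⟨le_rfl, hT.le⟩
  have hB := hb.bound_nonneg
  refine ⟨fieldSupNorm F f 0 + 4 * B * P ^ 2 * T, fun s hs x => ?_⟩
  have h1 := hf.abs_electricField_time_sub_le hT hF hb h0 hs x
  have h2 := abs_electricField_le (hf.integrable_density 0 h0) x
  have h3 := abs_sub_abs_le_abs_sub (electricField F f s x) (electricField F f 0 x)
  have h4 : 4 * B * P ^ 2 * |s - 0| ≤ 4 * B * P ^ 2 * T := by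
    gcongr
    rw [sub_zero, abs_of_nonneg hs.1]
    exact hs.2
  linarith

lemma IsC1Solution.continuous_electricField (hf : IsC1Solution T F f₀ f) (hT : 0 < T)
    (hF : Continuous F) (hb : HasVelocityBound T B P F f) :
    Continuous fun p : ℝ × ℝ => electricField F f (clampTime T p.1) p.2 := by
  refine continuous_prod_of_continuous_lipschitzWith'
    (fun p : ℝ × ℝ => electricField F f (clampTime T p.1) p.2) (Real.toNNReal (4 * B * P))
    (fun s => hf.lipschitzWith_electricField hb (clampTime_mem hT.le s)) fun x => ?_
  exact (hf.continuousOn_electricField_time hT hF hb x).comp_continuous (continuous_clampTime T)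
    (clampTime_mem hT.le)

/-- Backward characteristics, along which the solution is constant. -/
lemma IsC1Solution.exists_characteristic (hf : IsC1Solution T F f₀ f) (hT : 0 < T)
    (hF : Continuous F) (hb : HasVelocityBound T B P F f) {t : ℝ} (ht : t ∈ Icc 0 T) (x v : ℝ) :
    ∃ X V : ℝ → ℝ, IsTrajectory t (fun s => electricField F f s (X s)) X V ∧ X t = x ∧ V t = v ∧
      f t x v = f₀ (X 0) (V 0) := by
  obtain ⟨C, hC⟩ := hf.exists_field_bound hT hF hb
  have hsub : Icc 0 t ⊆ Icc 0 T := Icc_subset_Icc_right ht.2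
  obtain ⟨X, V, hXt, hVt, hX, hV⟩ := exists_trajectory ht.1
    (fun y => (hf.continuousOn_electricField_time hT hF hb y).mono hsub)
    (fun s hs => hf.lipschitzWith_electricField hb (hsub hs)) (fun s hs => hC s (hsub hs)) x v
  have hXc : ContinuousOn X (Icc 0 t) := fun s hs => (hX s hs).continuousWithinAt
  have htraj : IsTrajectory t (fun s => electricField F f s (X s)) X V := by
    refine ⟨?_, hX, hV⟩
    refine ((hf.continuous_electricField hT hF hb).comp_continuousOn
      (continuousOn_id.prodMk hXc)).congr fun s hs => ?_
    simp [clampTime_of_mem (hsub hs)]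
  refine ⟨X, V, htraj, hXt, hVt, ?_⟩
  have h1 := integral_eq_sub_of_hasDerivWithinAt_Icc (φ := fun r => f r (X r) (V r)) (φ' := fun _ => 0)
    (fun s hs => by simpa using hf.hasDerivWithinAt_trajectory hT ht.2 htraj hs)
    continuousOn_const ⟨le_rfl, ht.1⟩
  rw [intervalIntegral.integral_zero, hXt, hVt, hf.initial] at h1
  linarith

end Characteristics

/-! ### Behaviour at spatial infinity and Ampère's law -/

/-- The velocity gained up to time `t` by a particle at `-∞`, and lost by one at `+∞`. -/
noncomputable def farImpulse (F : ℝ → ℝ) (f : ℝ → ℝ → ℝ → ℝ) (t : ℝ) : ℝ :=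
  ∫ s in 0..t, halfCharge F f s

section Far

variable {T R B P : ℝ} {F : ℝ → ℝ} {f₀ : ℝ → ℝ → ℝ} {f : ℝ → ℝ → ℝ → ℝ}

/-- Being the limit of the field at `+∞`, the half charge inherits its Lipschitz bound in time. -/
lemma IsC1Solution.continuousOn_halfCharge (hf : IsC1Solution T F f₀ f) (hT : 0 < T)
    (hF : Continuous F) (hb : HasVelocityBound T B P F f) :
    ContinuousOn (halfCharge F f) (Icc 0 T) := by
  have hB := hb.bound_nonneg
  refine LipschitzOnWith.continuousOn (K := Real.toNNReal (4 * B * P ^ 2))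
    (LipschitzOnWith.of_dist_le_mul fun t ht r hr => ?_)
  rw [Real.coe_toNNReal _ (by positivity), Real.dist_eq, Real.dist_eq]
  have h1 := (tendsto_electricField (.inl rfl) (hf.integrable_density t ht)).sub
    (tendsto_electricField (.inl rfl) (hf.integrable_density r hr))
  simp only [one_mul] at h1
  exact le_of_tendsto h1.abs
    (Eventually.of_forall fun y => hf.abs_electricField_time_sub_le hT hF hb hr ht y)

lemma intervalIntegrable_fieldSupNorm
    (he : IntervalIntegrable (fieldSupNorm F f) volume 0 T) {t : ℝ} (ht : t ∈ Icc 0 T) :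
    IntervalIntegrable (fieldSupNorm F f) volume 0 t :=
  he.mono_set (by
    rw [uIcc_of_le ht.1, uIcc_of_le (ht.1.trans ht.2)]; exact Icc_subset_Icc_right ht.2)

lemma tendsto_atTop_of_abs_sub_le {σ D : ℝ} (hσ : σ = 1 ∨ σ = -1) {X : ℝ → ℝ}
    (h : ∀ y, |X y - σ * y| ≤ D) : Tendsto (fun y => σ * X y) atTop atTop := by
  have h1 : Tendsto (fun y : ℝ => y - D) atTop atTop :=
    tendsto_atTop_add_const_right _ _ tendsto_id
  refine tendsto_atTop_mono (fun y => ?_) h1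
  have := abs_le.1 (h y)
  rcases hσ with rfl | rfl <;> linarith

/-- The solution at spatial infinity is a translate of the background. -/
lemma IsC1Solution.tendsto_far (hf : IsC1Solution T F f₀ f) (hT : 0 < T)
    (hdata : IsAdmissibleData R F f₀) (he : IntervalIntegrable (fieldSupNorm F f) volume 0 T)
    (hb : HasVelocityBound T B P F f) {σ t : ℝ} (hσ : σ = 1 ∨ σ = -1) (ht : t ∈ Icc 0 T) (v : ℝ) :
    Tendsto (fun y => f t (σ * y) v) atTop (𝓝 (F (v + σ * farImpulse F f t))) := by
  have hF := hdata.background_contDiff.continuous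
  have hsub : Icc 0 t ⊆ Icc 0 T := Icc_subset_Icc_right ht.2
  have h0t : (0 : ℝ) ∈ Icc 0 t := ⟨le_rfl, ht.1⟩
  have het := intervalIntegrable_fieldSupNorm he ht
  choose X V htraj hXt hVt hfX using fun y => hf.exists_characteristic hT hF hb ht (σ * y) v
  have hle : ∀ y, ∀ s ∈ Icc 0 t, |electricField F f s (X y s)| ≤ fieldSupNorm F f s :=
    fun y s hs => abs_electricField_le (hf.integrable_density s (hsub hs)) _
  -- All these characteristics end at velocity `v`, so their displacement is bounded independently
  -- of `y`.
  have hXlim : ∀ s ∈ Icc 0 t, Tendsto (fun y => σ * X y s) atTop atTop := fun s hs => by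
    refine tendsto_atTop_of_abs_sub_le
      (D := (t - s) * |v| + ∫ τ in s..t, ∫ r in τ..t, fieldSupNorm F f r) hσ fun y => ?_
    have := (htraj y).abs_position_sub_le het (hle y) hs
    rwa [hXt, hVt] at this
  have hσσ : ∀ z, σ * (σ * z) = z := fun z => by rcases hσ with rfl | rfl <;> ring
  have hE : ∀ s ∈ Icc 0 t, Tendsto (fun y => electricField F f s (X y s)) atTop
      (𝓝 (σ * halfCharge F f s)) := fun s hs => by
    have := (tendsto_electricField hσ (hf.integrable_density s (hsub hs))).comp (hXlim s hs)
    simpa only [Function.comp_def, hσσ] using this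
  have hmem : ∀ s ∈ uIoc 0 t, s ∈ Icc 0 t := fun s hs => by
    rw [uIoc_of_le ht.1] at hs; exact Ioc_subset_Icc_self hs
  have hV0 : Tendsto (fun y => V y 0) atTop (𝓝 (v + σ * farImpulse F f t)) := by
    have h1 : Tendsto (fun y => ∫ s in 0..t, electricField F f s (X y s)) atTop
        (𝓝 (∫ s in 0..t, σ * halfCharge F f s)) := by
      refine intervalIntegral.tendsto_integral_filter_of_dominated_convergence (fieldSupNorm F f)
        (Eventually.of_forall fun y => ?_)
        (Eventually.of_forall fun y => Eventually.of_forall fun s hs => hle y s (hmem s hs)) het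
        (Eventually.of_forall fun s hs => hE s (hmem s hs))
      exact ((htraj y).continuousOn.mono hmem).aestronglyMeasurable measurableSet_uIoc
    rw [intervalIntegral.integral_const_mul] at h1
    refine (h1.const_add v).congr fun y => ?_
    rw [(htraj y).velocity_eq h0t, hVt]
  refine ((hF.tendsto _).comp hV0).congr' ?_
  filter_upwards [(hXlim 0 h0t).eventually_gt_atTop R] with y hy
  rw [Function.comp_apply, hfX, hdata.initial_eq_background]
  refine lt_of_lt_of_le hy ((le_abs_self _).trans (le_of_eq ?_))
  rw [abs_mul]
  rcases hσ with rfl | rfl <;> simp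

/-- After translation, evenness of `F` kills the first moment and only the shift remains. -/
lemma IsAdmissibleData.integral_mul_translate (hdata : IsAdmissibleData R F f₀) (c : ℝ) :
    ∫ v, v * F (v + c) = -c * ∫ v, F v := by
  have hF := hdata.background_contDiff.continuous
  have hi : Integrable F := hF.integrable_of_hasCompactSupport hdata.background_hasCompactSupport
  have hi' : Integrable fun v => v * F v :=
    (continuous_id.mul hF).integrable_of_hasCompactSupport
      hdata.background_hasCompactSupport.mul_left
  have hodd : ∫ v, v * F v = 0 := by
    have h1 := integral_neg_eq_self (fun v => v * F v) volume
    simp only [hdata.background_even, neg_mul, integral_neg] at h1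
    linarith
  have h2 := integral_add_right_eq_self (μ := volume) (fun w => (w - c) * F w) c
  simp only [add_sub_cancel_right] at h2
  rw [h2]
  simp only [sub_mul]
  rw [integral_sub hi' (hi.const_mul c), hodd, integral_const_mul]
  ring

lemma IsC1Solution.translate_eq_zero (hf : IsC1Solution T F f₀ f) (hT : 0 < T)
    (hdata : IsAdmissibleData R F f₀) (he : IntervalIntegrable (fieldSupNorm F f) volume 0 T)
    (hb : HasVelocityBound T B P F f) {σ t : ℝ} (hσ : σ = 1 ∨ σ = -1) (ht : t ∈ Icc 0 T) {v : ℝ}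
    (hv : P ≤ |v|) : F (v + σ * farImpulse F f t) = 0 := by
  have h := hf.tendsto_far hT hdata he hb hσ ht v
  simp only [hb.eq_zero t ht _ v hv] at h
  exact (tendsto_nhds_unique h tendsto_const_nhds)

lemma IsC1Solution.integral_mul_far (hf : IsC1Solution T F f₀ f) (hT : 0 < T)
    (hdata : IsAdmissibleData R F f₀) (he : IntervalIntegrable (fieldSupNorm F f) volume 0 T)
    (hb : HasVelocityBound T B P F f) {σ t : ℝ} (hσ : σ = 1 ∨ σ = -1) (ht : t ∈ Icc 0 T) :
    ∫ v in -P..P, v * F (v + σ * farImpulse F f t) = -(σ * farImpulse F f t) * ∫ v, F v := by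
  rw [← hdata.integral_mul_translate]
  refine (integral_eq_of_eq_zero fun v hv => ?_).symm
  rw [hf.translate_eq_zero hT hdata he hb hσ ht hv, mul_zero]

/-- The momentum density at spatial infinity. -/
lemma IsC1Solution.tendsto_momentum (hf : IsC1Solution T F f₀ f) (hT : 0 < T)
    (hdata : IsAdmissibleData R F f₀) (he : IntervalIntegrable (fieldSupNorm F f) volume 0 T)
    (hb : HasVelocityBound T B P F f) {σ t : ℝ} (hσ : σ = 1 ∨ σ = -1) (ht : t ∈ Icc 0 T) :
    Tendsto (fun y => momentum f t (σ * y)) atTop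
      (𝓝 (-(σ * farImpulse F f t) * ∫ v, F v)) := by
  rw [← hf.integral_mul_far hT hdata he hb hσ ht]
  simp only [hb.momentum_eq ht]
  refine intervalIntegral.tendsto_integral_filter_of_dominated_convergence (fun _ => P * B)
    (Eventually.of_forall fun y => ?_)
    (Eventually.of_forall fun y => Eventually.of_forall fun v hv => ?_) intervalIntegrable_const
    (Eventually.of_forall fun v _ => (hf.tendsto_far hT hdata he hb hσ ht v).const_mul v)
  · exact (continuous_id.mul ((hf.continuous_slice hT ht).comp
      (by fun_prop : Continuous fun v : ℝ => (σ * y, v)))).aestronglyMeasurable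
  · rw [uIoc_of_le (by linarith [hb.pos])] at hv
    rw [norm_mul]
    exact mul_le_mul (abs_le.2 ⟨hv.1.le, hv.2⟩) (hb.abs_le t ht _ v) (abs_nonneg _) hb.pos.le

/-- The Ampère law: the field changes in time by the momentum density. -/
lemma IsC1Solution.electricField_time_sub (hf : IsC1Solution T F f₀ f) (hT : 0 < T)
    (hdata : IsAdmissibleData R F f₀) (he : IntervalIntegrable (fieldSupNorm F f) volume 0 T)
    (hb : HasVelocityBound T B P F f) {t : ℝ} (ht : t ∈ Icc 0 T) (x : ℝ) :
    electricField F f t x - electricField F f 0 x = ∫ s in 0..t, momentum f s x := by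
  have hF := hdata.background_contDiff.continuous
  have h0 : (0 : ℝ) ∈ Icc 0 T := ⟨le_rfl, hT.le⟩
  have hmem : ∀ s ∈ uIoc 0 t, s ∈ Icc 0 T := fun s hs => by
    rw [uIoc_of_le ht.1] at hs; exact ⟨hs.1.le, hs.2.trans ht.2⟩
  refine tendsto_nhds_unique (hf.tendsto_field_balance hT hF hb h0 ht x) ?_
  have hi := fun y => hf.intervalIntegrable_momentum hT hb y h0 ht
  refine intervalIntegral.tendsto_integral_filter_of_dominated_convergence
    (fun _ => 4 * B * P ^ 2)
    (Eventually.of_forall fun L => ?_)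
    (Eventually.of_forall fun L => Eventually.of_forall fun s hs => ?_) intervalIntegrable_const
    (Eventually.of_forall fun s hs => ?_)
  · have := ((hi x).sub (((hi L).add (hi (-L))).div_const 2)).def'.aestronglyMeasurable
    exact this
  · have h1 := abs_le.1 (hb.abs_momentum_le (hmem s hs) x)
    have h2 := abs_le.1 (hb.abs_momentum_le (hmem s hs) L)
    have h3 := abs_le.1 (hb.abs_momentum_le (hmem s hs) (-L))
    rw [Real.norm_eq_abs, abs_le]
    constructor <;> linarith
  · have h1 := hf.tendsto_momentum hT hdata he hb (.inl rfl) (hmem s hs)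
    have h2 := hf.tendsto_momentum hT hdata he hb (.inr rfl) (hmem s hs)
    -- The limits at the two ends are opposite, so the average flux through infinity vanishes.
    have h3 := ((h1.add h2).div_const 2).const_sub (momentum f s x)
    simp only [one_mul, neg_one_mul] at h3
    convert h3 using 2
    ring

/-- This is Ampère's law in the limit `x → +∞`: the integrated form of `A' = -ω² a`. -/
lemma IsC1Solution.halfCharge_eq (hf : IsC1Solution T F f₀ f) (hT : 0 < T)
    (hdata : IsAdmissibleData R F f₀) (he : IntervalIntegrable (fieldSupNorm F f) volume 0 T)
    (hb : HasVelocityBound T B P F f) {t : ℝ} (ht : t ∈ Icc 0 T) :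
    halfCharge F f t = halfCharge F f 0 + ∫ s in 0..t, -(∫ v, F v) * farImpulse F f s := by
  have h0 : (0 : ℝ) ∈ Icc 0 T := ⟨le_rfl, hT.le⟩
  have hmem : ∀ s ∈ uIoc 0 t, s ∈ Icc 0 T := fun s hs => by
    rw [uIoc_of_le ht.1] at hs; exact ⟨hs.1.le, hs.2.trans ht.2⟩
  have h1 := (tendsto_electricField (.inl rfl) (hf.integrable_density t ht)).sub
    (tendsto_electricField (.inl rfl) (hf.integrable_density 0 h0))
  simp only [one_mul, hf.electricField_time_sub hT hdata he hb ht] at h1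
  have h2 : Tendsto (fun y => ∫ s in 0..t, momentum f s y) atTop
      (𝓝 (∫ s in 0..t, -(∫ v, F v) * farImpulse F f s)) := by
    refine intervalIntegral.tendsto_integral_filter_of_dominated_convergence
      (fun _ => 2 * B * P ^ 2)
      (Eventually.of_forall fun y =>
        (hf.intervalIntegrable_momentum hT hb y h0 ht).def'.aestronglyMeasurable)
      (Eventually.of_forall fun y => Eventually.of_forall fun s hs =>
        hb.abs_momentum_le (hmem s hs) y) intervalIntegrable_const
      (Eventually.of_forall fun s hs => ?_)
    have h3 := hf.tendsto_momentum hT hdata he hb (.inl rfl) (hmem s hs)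
    simp only [one_mul] at h3
    convert h3 using 2
    ring
  linarith [tendsto_nhds_unique h1 h2]

lemma IsC1Solution.chargeDensity_zero (hf : IsC1Solution T F f₀ f)
    (hdata : IsAdmissibleData R F f₀) {x : ℝ} (hx : R < |x|) : chargeDensity F f 0 x = 0 := by
  unfold chargeDensity
  simp [hf.initial, hdata.initial_eq_background x _ hx]

lemma IsC1Solution.halfCharge_zero (hf : IsC1Solution T F f₀ f)
    (hdata : IsAdmissibleData R F f₀) : halfCharge F f 0 = initialFieldStrength R F f₀ := by
  unfold halfCharge initialFieldStrength
  have hR := hdata.radius_pos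
  rw [intervalIntegral.integral_of_le (by linarith), ← integral_Icc_eq_integral_Ioc,
    ← setIntegral_eq_integral_of_forall_compl_eq_zero (s := Icc (-R) R) fun y hy => ?_]
  · simp only [chargeDensity, hf.initial]
  · refine hf.chargeDensity_zero hdata ?_
    by_contra h
    exact hy (abs_le.1 (not_lt.1 h))

lemma IsC1Solution.electricField_zero (hf : IsC1Solution T F f₀ f) (hT : 0 < T)
    (hdata : IsAdmissibleData R F f₀) {x : ℝ} (hx : R < |x|) :
    electricField F f 0 x = sgn x * halfCharge F f 0 := by
  have hR := hdata.radius_pos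
  have hi := hf.integrable_density 0 ⟨le_rfl, hT.le⟩
  by_cases h : 0 ≤ x
  · rw [abs_of_nonneg h] at hx
    rw [electricField_eq_sub_integral_Ioi hi, sgn, if_pos h, setIntegral_eq_zero_of_forall_eq_zero]
    · ring
    · intro y hy
      exact hf.chargeDensity_zero hdata (lt_of_lt_of_le (hx.trans hy) (le_abs_self y))
  · rw [abs_of_neg (not_le.1 h)] at hx
    rw [electricField_eq hi, sgn, if_neg h, setIntegral_eq_zero_of_forall_eq_zero]
    · ring
    · intro y hy
      exact hf.chargeDensity_zero hdata
        (lt_of_lt_of_le (hx.trans_le (neg_le_neg hy)) (neg_le_abs y))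

end Far

/-! ### The harmonic oscillator at infinity -/

section Oscillation

variable {T R B P : ℝ} {F : ℝ → ℝ} {f₀ : ℝ → ℝ → ℝ} {f : ℝ → ℝ → ℝ → ℝ}

lemma hasDerivWithinAt_integral_Icc {u : ℝ → ℝ} (hT : 0 ≤ T) (hu : ContinuousOn u (Icc 0 T)) {t : ℝ}
    (ht : t ∈ Icc 0 T) : HasDerivWithinAt (fun r => ∫ s in 0..r, u s) (u t) (Icc 0 T) t := by
  have hc : Continuous fun s => u (clampTime T s) :=
    hu.comp_continuous (continuous_clampTime T) (clampTime_mem hT)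
  have h := (hc.integral_hasStrictDerivAt 0 t).hasDerivAt.hasDerivWithinAt (s := Icc 0 T)
  rw [clampTime_of_mem ht] at h
  refine h.congr_of_mem (fun r hr => ?_) ht
  refine intervalIntegral.integral_congr fun s hs => ?_
  rw [uIcc_of_le hr.1] at hs
  simp only [clampTime_of_mem (⟨hs.1, hs.2.trans hr.2⟩ : s ∈ Icc 0 T)]

lemma eq_of_hasDerivWithinAt_zero {φ : ℝ → ℝ}
    (h : ∀ s ∈ Icc 0 T, HasDerivWithinAt φ 0 (Icc 0 T) s) {t : ℝ} (ht : t ∈ Icc 0 T) :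
    φ t = φ 0 := by
  have := integral_eq_sub_of_hasDerivWithinAt_Icc (φ' := fun _ => 0)
    (fun s hs => (h s ⟨hs.1, hs.2.trans ht.2⟩).mono (Icc_subset_Icc_right ht.2))
    continuousOn_const ⟨le_rfl, ht.1⟩
  rw [intervalIntegral.integral_zero] at this
  linarith

/-- The harmonic oscillator `A' = -ω² a`, `a' = A` with `a(0) = 0`. -/
lemma harmonic_oscillator {A a : ℝ → ℝ} {ω : ℝ}
    (ha : ∀ s ∈ Icc 0 T, HasDerivWithinAt a (A s) (Icc 0 T) s)
    (hA : ∀ s ∈ Icc 0 T, HasDerivWithinAt A (-ω ^ 2 * a s) (Icc 0 T) s) (h0 : a 0 = 0) {t : ℝ}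
    (ht : t ∈ Icc 0 T) :
    A t = A 0 * Real.cos (ω * t) ∧ ω * a t = A 0 * Real.sin (ω * t) := by
  have hcos (s : ℝ) : HasDerivWithinAt (fun r => Real.cos (ω * r)) (-Real.sin (ω * s) * ω)
      (Icc 0 T) s :=
    ((Real.hasDerivAt_cos _).comp s (by simpa using (hasDerivAt_id s).const_mul ω)).hasDerivWithinAt
  have hsin (s : ℝ) : HasDerivWithinAt (fun r => Real.sin (ω * r)) (Real.cos (ω * s) * ω)
      (Icc 0 T) s :=
    ((Real.hasDerivAt_sin _).comp s (by simpa using (hasDerivAt_id s).const_mul ω)).hasDerivWithinAt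
  -- In coordinates rotating with angle `ω s`, the vector `(A, ω a)` is constant; `hp` and `hq` are
  -- its components. Rotating back needs no division by `ω`.
  have hp := eq_of_hasDerivWithinAt_zero
    (φ := fun s => A s * Real.cos (ω * s) + ω * a s * Real.sin (ω * s)) (fun s hs => by
      convert! ((hA s hs).mul (hcos s)).add (((ha s hs).const_mul ω).mul (hsin s)) using 1
      ring) ht
  have hq := eq_of_hasDerivWithinAt_zero
    (φ := fun s => A s * Real.sin (ω * s) - ω * a s * Real.cos (ω * s)) (fun s hs => by
      convert! ((hA s hs).mul (hsin s)).sub (((ha s hs).const_mul ω).mul (hcos s)) using 1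
      ring) ht
  simp only [mul_zero, Real.cos_zero, Real.sin_zero, h0, mul_one, add_zero,
    sub_zero] at hp hq
  have hcs := Real.sin_sq_add_cos_sq (ω * t)
  constructor
  · linear_combination Real.cos (ω * t) * hp + Real.sin (ω * t) * hq - A t * hcs
  · linear_combination Real.sin (ω * t) * hp - Real.cos (ω * t) * hq - ω * a t * hcs

lemma IsAdmissibleData.frequency_sq (hdata : IsAdmissibleData R F f₀) :
    frequency F ^ 2 = ∫ v, F v :=
  Real.sq_sqrt (integral_nonneg hdata.background_nonneg)

lemma IsC1Solution.continuousOn_farImpulse (hf : IsC1Solution T F f₀ f) (hT : 0 < T)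
    (hF : Continuous F) (hb : HasVelocityBound T B P F f) :
    ContinuousOn (farImpulse F f) (Icc 0 T) := fun _ hs =>
  (hasDerivWithinAt_integral_Icc hT.le
    (hf.continuousOn_halfCharge hT hF hb) hs).continuousWithinAt

lemma IsC1Solution.halfCharge_eq_cos (hf : IsC1Solution T F f₀ f) (hT : 0 < T)
    (hdata : IsAdmissibleData R F f₀) (he : IntervalIntegrable (fieldSupNorm F f) volume 0 T)
    (hb : HasVelocityBound T B P F f) {t : ℝ} (ht : t ∈ Icc 0 T) :
    halfCharge F f t = initialFieldStrength R F f₀ * Real.cos (frequency F * t) ∧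
      frequency F * farImpulse F f t =
        initialFieldStrength R F f₀ * Real.sin (frequency F * t) := by
  have hF := hdata.background_contDiff.continuous
  rw [← hf.halfCharge_zero hdata]
  refine harmonic_oscillator (fun s hs => hasDerivWithinAt_integral_Icc hT.le
    (hf.continuousOn_halfCharge hT hF hb) hs) (fun s hs => ?_) intervalIntegral.integral_same ht
  have h1 := (hasDerivWithinAt_integral_Icc hT.le (continuousOn_const.mul
    (hf.continuousOn_farImpulse hT hF hb) : ContinuousOn
      (fun s => -(∫ v, F v) * farImpulse F f s) (Icc 0 T)) hs).const_add (halfCharge F f 0)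
  rw [hdata.frequency_sq]
  exact h1.congr_of_mem (fun r hr => hf.halfCharge_eq hT hdata he hb hr) hs

end Oscillation

/-! ### From infinity to the exterior region -/

section Exterior

variable {T R B P : ℝ} {F : ℝ → ℝ} {f₀ : ℝ → ℝ → ℝ} {f : ℝ → ℝ → ℝ → ℝ}

lemma sgn_eq_or (x : ℝ) : sgn x = 1 ∨ sgn x = -1 := by
  unfold sgn; split_ifs <;> simp

lemma sgn_eq_of_abs_sub_lt {x y : ℝ} (h : |y - x| < |x|) : sgn y = sgn x := by
  unfold sgn
  rw [abs_lt] at h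
  by_cases hx : 0 ≤ x
  · rw [abs_of_nonneg hx] at h
    rw [if_pos hx, if_pos (by linarith)]
  · rw [abs_of_neg (not_le.1 hx)] at h
    rw [if_neg hx, if_neg (by linarith)]

lemma velocityRadius_nonneg (F : ℝ → ℝ) (f : ℝ → ℝ → ℝ → ℝ) (t : ℝ) : 0 ≤ velocityRadius F f t := by
  refine Real.sSup_nonneg ?_
  rintro _ ⟨v, -, -, -, -, rfl⟩
  exact abs_nonneg v

lemma HasVelocityBound.bddAbove (hb : HasVelocityBound T B P F f) {t : ℝ} (ht : t ∈ Icc 0 T) :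
    BddAbove {r : ℝ | ∃ v x : ℝ, ∃ τ ∈ Icc 0 t, F v - f τ x v ≠ 0 ∧ r = |v|} := by
  refine ⟨P, ?_⟩
  rintro _ ⟨v, x, τ, hτ, hne, rfl⟩
  by_contra h
  have h' := (not_le.1 h).le
  exact hne (by rw [hb.background_eq_zero v h',
    hb.eq_zero τ ⟨hτ.1, hτ.2.trans ht.2⟩ x v h', sub_zero])

lemma HasVelocityBound.velocityRadius_mono (hb : HasVelocityBound T B P F f) {s t : ℝ}
    (ht : t ∈ Icc 0 T) (hst : s ≤ t) : velocityRadius F f s ≤ velocityRadius F f t := by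
  refine Real.sSup_le ?_ (velocityRadius_nonneg F f t)
  rintro _ ⟨v, x, τ, hτ, hne, rfl⟩
  exact le_csSup (hb.bddAbove ht) ⟨v, x, τ, ⟨hτ.1, hτ.2.trans hst⟩, hne, rfl⟩

lemma HasVelocityBound.eq_background (hb : HasVelocityBound T B P F f) {t v : ℝ}
    (ht : t ∈ Icc 0 T) (hv : velocityRadius F f t < |v|) (x : ℝ) : f t x v = F v := by
  by_contra h
  exact not_lt.2 (le_csSup (hb.bddAbove ht)
    ⟨v, x, t, ⟨ht.1, le_rfl⟩, sub_ne_zero.2 (Ne.symm h), rfl⟩) hv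

/-- The growth of `spatialRadius` from `s` to `t` dominates the displacement of any particle whose
final speed is at most `velocityRadius F f t`. This makes the exterior region invariant along such
backward characteristics. -/
lemma HasVelocityBound.spatialRadius_add_le (hb : HasVelocityBound T B P F f)
    (he : IntervalIntegrable (fieldSupNorm F f) volume 0 T) {s t : ℝ} (ht : t ∈ Icc 0 T)
    (hs : s ∈ Icc 0 t) :
    spatialRadius R F f s + (t - s) * velocityRadius F f t
      + ∫ τ in s..t, ∫ r in τ..t, fieldSupNorm F f r ≤ spatialRadius R F f t := by
  have het := intervalIntegrable_fieldSupNorm he ht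
  have hes := intervalIntegrable_fieldSupNorm he (t := s) ⟨hs.1, hs.2.trans ht.2⟩
  have hct := IsTrajectory.continuousOn_tail_integral het ht.1
  have hcs := IsTrajectory.continuousOn_tail_integral hes hs.1
  have hi1 : IntervalIntegrable (fun τ => ∫ r in τ..t, fieldSupNorm F f r) volume 0 s :=
    (hct.mono (by rw [uIcc_of_le hs.1]; exact Icc_subset_Icc_right hs.2)).intervalIntegrable
  have hi2 : IntervalIntegrable (fun τ => ∫ r in τ..t, fieldSupNorm F f r) volume s t :=
    (hct.mono (by rw [uIcc_of_le hs.2]; exact Icc_subset_Icc_left hs.1)).intervalIntegrable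
  have hi3 : IntervalIntegrable (fun τ => ∫ r in τ..s, fieldSupNorm F f r) volume 0 s :=
    (hcs.mono (by rw [uIcc_of_le hs.1])).intervalIntegrable
  have h1 := intervalIntegral.integral_add_adjacent_intervals hi1 hi2
  have h2 : ∫ τ in 0..s, ∫ r in τ..s, fieldSupNorm F f r
      ≤ ∫ τ in 0..s, ∫ r in τ..t, fieldSupNorm F f r := by
    refine intervalIntegral.integral_mono_on hs.1 hi3 hi1 fun τ hτ => ?_
    refine intervalIntegral.integral_mono_interval le_rfl hτ.2 hs.2
      (Eventually.of_forall fun r => fieldSupNorm_nonneg F f r) (het.mono_set ?_)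
    rw [uIcc_of_le (hτ.2.trans hs.2), uIcc_of_le ht.1]
    exact Icc_subset_Icc_left hτ.1
  have h3 : s * velocityRadius F f s ≤ s * velocityRadius F f t :=
    mul_le_mul_of_nonneg_left (hb.velocityRadius_mono ht hs.2) hs.1
  unfold spatialRadius
  linarith

lemma HasVelocityBound.spatialRadius_mono (hb : HasVelocityBound T B P F f)
    (he : IntervalIntegrable (fieldSupNorm F f) volume 0 T) {s t : ℝ} (ht : t ∈ Icc 0 T)
    (hs : s ∈ Icc 0 t) : spatialRadius R F f s ≤ spatialRadius R F f t := by
  have h1 := hb.spatialRadius_add_le (R := R) he ht hs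
  have h2 : 0 ≤ (t - s) * velocityRadius F f t :=
    mul_nonneg (sub_nonneg.2 hs.2) (velocityRadius_nonneg F f t)
  have h3 : 0 ≤ ∫ τ in s..t, ∫ r in τ..t, fieldSupNorm F f r :=
    intervalIntegral.integral_nonneg hs.2 fun τ hτ =>
      intervalIntegral.integral_nonneg hτ.2 fun r _ => fieldSupNorm_nonneg F f r
  linarith

lemma spatialRadius_zero (R : ℝ) (F : ℝ → ℝ) (f : ℝ → ℝ → ℝ → ℝ) : spatialRadius R F f 0 = R := by
  simp [spatialRadius]

/-- In the exterior region the solution stays close to the translated background as long as the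
field stays close to its value at infinity. -/
lemma IsC1Solution.abs_sub_translate_le (hf : IsC1Solution T F f₀ f) (hT : 0 < T)
    (hdata : IsAdmissibleData R F f₀) (he : IntervalIntegrable (fieldSupNorm F f) volume 0 T)
    (hb : HasVelocityBound T B P F f) {Λ : ℝ≥0} (hΛ : LipschitzWith Λ F) {t δ : ℝ}
    (ht : t ∈ Icc 0 T)
    (hδ : ∀ s ∈ Icc 0 t, ∀ y, spatialRadius R F f s < |y| →
      |electricField F f s y - sgn y * halfCharge F f s| ≤ δ)
    {x : ℝ} (hx : spatialRadius R F f t < |x|) (v : ℝ) :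
    |f t x v - F (v + sgn x * farImpulse F f t)| ≤ Λ * (δ * T) := by
  have hF := hdata.background_contDiff.continuous
  have h0t : (0 : ℝ) ∈ Icc 0 t := ⟨le_rfl, ht.1⟩
  have hδ0 : 0 ≤ δ := (abs_nonneg _).trans (hδ t ⟨ht.1, le_rfl⟩ x hx)
  -- For `|v|` beyond `velocityRadius` the solution equals `F v` at every `x`; comparing with its
  -- limit at infinity shows that the translate equals `F v` too. Only the other velocities need
  -- characteristics.
  rcases lt_or_ge (velocityRadius F f t) |v| with hv | hv
  · have h1 := hf.tendsto_far hT hdata he hb (sgn_eq_or x) ht v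
    simp only [hb.eq_background ht hv] at h1
    rw [hb.eq_background ht hv, ← tendsto_nhds_unique h1 tendsto_const_nhds, sub_self, abs_zero]
    positivity
  have hsub : Icc 0 t ⊆ Icc 0 T := Icc_subset_Icc_right ht.2
  have het := intervalIntegrable_fieldSupNorm he ht
  obtain ⟨X, V, htraj, hXt, hVt, hfX⟩ := hf.exists_characteristic hT hF hb ht x v
  -- The displacement is less than `|x| - spatialRadius R F f s`, so the particle stays outside and
  -- cannot change sides.
  have hX : ∀ s ∈ Icc 0 t, spatialRadius R F f s < |X s| ∧ sgn (X s) = sgn x := by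
    intro s hs
    have h1 := htraj.abs_position_sub_le het
      (fun r hr => abs_electricField_le (hf.integrable_density r (hsub hr)) _) hs
    rw [hXt, hVt] at h1
    have h2 := hb.spatialRadius_add_le (R := R) he ht hs
    have h3 : (t - s) * |v| ≤ (t - s) * velocityRadius F f t :=
      mul_le_mul_of_nonneg_left hv (sub_nonneg.2 hs.2)
    have h4 := hb.spatialRadius_mono (R := R) he (hsub hs) (s := 0) ⟨le_rfl, hs.1⟩
    rw [spatialRadius_zero] at h4
    have h5 := hdata.radius_pos
    have h6 := abs_sub_abs_le_abs_sub x (X s)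
    rw [abs_sub_comm] at h6
    exact ⟨by linarith, sgn_eq_of_abs_sub_lt (by linarith)⟩
  have hX0 := (hX 0 h0t).1
  rw [spatialRadius_zero] at hX0
  have hAi : IntervalIntegrable (fun s => sgn x * halfCharge F f s) volume 0 t :=
    ((continuousOn_const.mul (hf.continuousOn_halfCharge hT hF hb)).mono
      (by rwa [uIcc_of_le ht.1])).intervalIntegrable
  have hEi : IntervalIntegrable (fun s => electricField F f s (X s)) volume 0 t :=
    (htraj.continuousOn.mono (by rw [uIcc_of_le ht.1])).intervalIntegrable
  rw [hfX, hdata.initial_eq_background _ _ hX0, htraj.velocity_eq h0t, hVt]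
  have h1 := hΛ.dist_le_mul (v + ∫ s in 0..t, electricField F f s (X s))
    (v + sgn x * farImpulse F f t)
  rw [Real.dist_eq, Real.dist_eq, add_sub_add_left_eq_sub, farImpulse,
    ← intervalIntegral.integral_const_mul, ← intervalIntegral.integral_sub hEi hAi] at h1
  have h2 : |∫ s in 0..t, (electricField F f s (X s) - sgn x * halfCharge F f s)|
      ≤ δ * |t - 0| := by
    rw [← Real.norm_eq_abs]
    refine intervalIntegral.norm_integral_le_of_norm_le_const fun s hs => ?_
    rw [uIoc_of_le ht.1] at hs
    have hs' := Ioc_subset_Icc_self hs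
    have h3 := hδ s hs' (X s) (hX s hs').1
    rwa [(hX s hs').2] at h3
  rw [farImpulse]
  rw [← intervalIntegral.integral_const_mul]
  refine h1.trans (mul_le_mul_of_nonneg_left (h2.trans ?_) Λ.2)
  rw [sub_zero, abs_of_nonneg ht.1]
  exact mul_le_mul_of_nonneg_left ht.2 hδ0

lemma IsC1Solution.abs_momentum_sub_far_le (hf : IsC1Solution T F f₀ f) (hT : 0 < T)
    (hdata : IsAdmissibleData R F f₀) (he : IntervalIntegrable (fieldSupNorm F f) volume 0 T)
    (hb : HasVelocityBound T B P F f) {t x δ : ℝ} (ht : t ∈ Icc 0 T)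
    (hδ : ∀ v, |f t x v - F (v + sgn x * farImpulse F f t)| ≤ δ) :
    |momentum f t x - -(sgn x * farImpulse F f t) * ∫ v, F v| ≤ 2 * P ^ 2 * δ := by
  have hF := hdata.background_contDiff.continuous
  have hc : Continuous fun v => f t x v :=
    (hf.continuous_slice hT ht).comp (by fun_prop : Continuous fun v : ℝ => (x, v))
  rw [← hf.integral_mul_far hT hdata he hb (sgn_eq_or x) ht, hb.momentum_eq ht,
    ← intervalIntegral.integral_sub (Continuous.intervalIntegrable (by fun_prop) _ _)
      (Continuous.intervalIntegrable (by fun_prop) _ _)]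
  have h1 := intervalIntegral.norm_integral_le_of_norm_le_const (a := -P) (b := P) (C := P * δ)
    (f := fun v => v * f t x v - v * F (v + sgn x * farImpulse F f t)) fun v hv => by
      rw [uIoc_of_le (by linarith [hb.pos])] at hv
      rw [← mul_sub, norm_mul]
      exact mul_le_mul (abs_le.2 ⟨hv.1.le, hv.2⟩) (hδ v) (abs_nonneg _) hb.pos.le
  rw [sub_neg_eq_add, abs_of_pos (by linarith [hb.pos])] at h1
  calc _ ≤ _ := h1
    _ = _ := by ring

/-- Subtracting the equation at infinity from Ampère's law leaves no initial term, since for `|x| >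
R` the initial field already has its value at infinity. -/
lemma IsC1Solution.electricField_sub_far (hf : IsC1Solution T F f₀ f) (hT : 0 < T)
    (hdata : IsAdmissibleData R F f₀) (he : IntervalIntegrable (fieldSupNorm F f) volume 0 T)
    (hb : HasVelocityBound T B P F f) {t x : ℝ} (ht : t ∈ Icc 0 T) (hx : R < |x|) :
    electricField F f t x - sgn x * halfCharge F f t
      = ∫ s in 0..t, (momentum f s x - -(sgn x * farImpulse F f s) * ∫ v, F v) := by
  have hF := hdata.background_contDiff.continuous
  have h0 : (0 : ℝ) ∈ Icc 0 T := ⟨le_rfl, hT.le⟩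
  have hsub : uIcc 0 t ⊆ Icc 0 T := by
    rw [uIcc_of_le ht.1]; exact Icc_subset_Icc_right ht.2
  have hi : IntervalIntegrable (fun s => -(∫ v, F v) * farImpulse F f s) volume 0 t :=
    ((continuousOn_const.mul (hf.continuousOn_farImpulse hT hF hb)).mono hsub).intervalIntegrable
  have h1 := hf.electricField_time_sub hT hdata he hb ht x
  have h2 := hf.halfCharge_eq hT hdata he hb ht
  have h3 := hf.electricField_zero hT hdata hx
  have h4 : ∀ s, -(sgn x * farImpulse F f s) * (∫ v, F v)
      = sgn x * (-(∫ v, F v) * farImpulse F f s) := fun s => by ring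
  simp_rw [h4]
  rw [intervalIntegral.integral_sub (hf.intervalIntegrable_momentum hT hb x h0 ht)
    (hi.const_mul _), intervalIntegral.integral_const_mul]
  rw [h2]
  linear_combination h1 + h3

/-- In the exterior region the field equals its value at infinity. -/
lemma IsC1Solution.electricField_exterior (hf : IsC1Solution T F f₀ f) (hT : 0 < T)
    (hdata : IsAdmissibleData R F f₀) (he : IntervalIntegrable (fieldSupNorm F f) volume 0 T)
    (hb : HasVelocityBound T B P F f) {t x : ℝ} (ht : t ∈ Icc 0 T)
    (hx : spatialRadius R F f t < |x|) :
    electricField F f t x = sgn x * halfCharge F f t := by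
  have hF := hdata.background_contDiff.continuous
  obtain ⟨Λ, hΛ⟩ := ContDiff.lipschitzWith_of_hasCompactSupport
    hdata.background_hasCompactSupport hdata.background_contDiff one_ne_zero
  obtain ⟨C₁, hC₁⟩ := hf.exists_field_bound hT hF hb
  obtain ⟨C₂, hC₂⟩ := isCompact_Icc.exists_bound_of_continuousOn
    (hf.continuousOn_halfCharge hT hF hb)
  -- `Λ * T` converts a field error into an error of `f`, and `2 * P ^ 2` converts that into a
  -- momentum error.
  set c : ℝ := 2 * P ^ 2 * (Λ * T) with hc
  have hiter : ∀ n : ℕ, ∀ t ∈ Icc 0 T, ∀ x, spatialRadius R F f t < |x| →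
      |electricField F f t x - sgn x * halfCharge F f t|
        ≤ (C₁ + C₂) * ((c * t) ^ n / n.factorial) := by
    intro n
    induction n with
    | zero =>
      intro t ht x _
      have h1 := hC₁ t ht x
      have h2 := hC₂ t ht
      have h3 := abs_sub (electricField F f t x) (sgn x * halfCharge F f t)
      have h4 : |sgn x * halfCharge F f t| = ‖halfCharge F f t‖ := by
        rw [abs_mul, Real.norm_eq_abs]
        rcases sgn_eq_or x with h | h <;> simp [h]
      simp only [pow_zero, Nat.factorial_zero, Nat.cast_one, div_one, mul_one]
      linarith
    | succ n ih =>
      intro t ht x hx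
      have hxs : ∀ s ∈ Icc 0 t, spatialRadius R F f s < |x| := fun s hs =>
        (hb.spatialRadius_mono he ht hs).trans_lt hx
      have hxR : R < |x| := by
        have := hxs 0 ⟨le_rfl, ht.1⟩
        rwa [spatialRadius_zero] at this
      have hc0 : 0 ≤ c := by positivity
      have hM : 0 ≤ C₁ + C₂ := add_nonneg ((abs_nonneg _).trans (hC₁ t ht x))
        ((norm_nonneg _).trans (hC₂ t ht))
      rw [hf.electricField_sub_far hT hdata he hb ht hxR, ← Real.norm_eq_abs]
      have hprim : ∫ s in 0..t, c * ((C₁ + C₂) * ((c * s) ^ n / n.factorial))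
          = (C₁ + C₂) * ((c * t) ^ (n + 1) / (n + 1).factorial) := by
        have h1 : ∀ s : ℝ, c * ((C₁ + C₂) * ((c * s) ^ n / n.factorial))
            = (c ^ (n + 1) * (C₁ + C₂) / n.factorial) * s ^ n := fun s => by
          rw [mul_pow]; ring
        simp_rw [h1]
        rw [intervalIntegral.integral_const_mul, integral_pow, Nat.factorial_succ, mul_pow]
        push_cast
        have : (n.factorial : ℝ) ≠ 0 := by positivity
        field_simp
        ring
      rw [← hprim]
      refine intervalIntegral.norm_integral_le_of_norm_le ht.1
        (Eventually.of_forall fun s hs => ?_) (Continuous.intervalIntegrable (by fun_prop) _ _)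
      have hs' := Ioc_subset_Icc_self hs
      have hsT : s ∈ Icc 0 T := ⟨hs'.1, hs'.2.trans ht.2⟩
      -- The induction bound increases with time, so its value at `s` serves as a constant `δ` on
      -- all of `[0, s]`.
      have hstep := hf.abs_sub_translate_le hT hdata he hb hΛ
        (δ := (C₁ + C₂) * ((c * s) ^ n / n.factorial)) hsT (fun r hr y hy => by
          refine (ih r ⟨hr.1, hr.2.trans hsT.2⟩ y hy).trans ?_
          have := hr.1
          gcongr
          exact hr.2) (hxs s hs')
      refine (hf.abs_momentum_sub_far_le hT hdata he hb hsT hstep).trans (le_of_eq ?_)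
      rw [hc]
      ring
  have hlim : Tendsto (fun n : ℕ => (C₁ + C₂) * ((c * t) ^ n / n.factorial)) atTop (𝓝 0) := by
    simpa using (FloorSemiring.tendsto_pow_div_factorial_atTop (c * t)).const_mul (C₁ + C₂)
  exact sub_eq_zero.1 (abs_eq_zero.1 (le_antisymm
    (ge_of_tendsto hlim (Eventually.of_forall fun n => hiter n t ht x hx)) (abs_nonneg _)))

lemma IsC1Solution.eq_translate_exterior (hf : IsC1Solution T F f₀ f) (hT : 0 < T)
    (hdata : IsAdmissibleData R F f₀) (he : IntervalIntegrable (fieldSupNorm F f) volume 0 T)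
    (hb : HasVelocityBound T B P F f) {t x : ℝ} (ht : t ∈ Icc 0 T)
    (hx : spatialRadius R F f t < |x|) (v : ℝ) :
    f t x v = F (v + sgn x * farImpulse F f t) := by
  obtain ⟨Λ, hΛ⟩ := ContDiff.lipschitzWith_of_hasCompactSupport
    hdata.background_hasCompactSupport hdata.background_contDiff one_ne_zero
  have h := hf.abs_sub_translate_le hT hdata he hb hΛ (δ := 0) ht (fun s hs y hy => by
    rw [hf.electricField_exterior hT hdata he hb ⟨hs.1, hs.2.trans ht.2⟩ hy, sub_self, abs_zero]) hx v
  rw [zero_mul, mul_zero] at h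
  exact sub_eq_zero.1 (abs_eq_zero.1 (le_antisymm h (abs_nonneg _)))

lemma IsAdmissibleData.background_eq_zero_of_frequency (hdata : IsAdmissibleData R F f₀)
    (h : frequency F = 0) : F = 0 := by
  have hF := hdata.background_contDiff.continuous
  have h1 := hdata.frequency_sq
  rw [h, zero_pow two_ne_zero] at h1
  exact (hF.ae_eq_iff_eq volume continuous_const).1
    ((integral_eq_zero_iff_of_nonneg hdata.background_nonneg
      (hF.integrable_of_hasCompactSupport hdata.background_hasCompactSupport)).1 h1.symm)

end Exterior

end VlasovPoisson

theorem theorem2 (T R : ℝ) (hT : 0 < T) (F : ℝ → ℝ) (f₀ : ℝ → ℝ → ℝ)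
    (hdata : VlasovPoisson.IsAdmissibleData R F f₀)
    (f : ℝ → ℝ → ℝ → ℝ) (hf : VlasovPoisson.IsC1Solution T F f₀ f)
    (hE : VlasovPoisson.HasFieldBound T F f)
    (t : ℝ) (ht : t ∈ Set.Icc 0 T) (x : ℝ) (hx : VlasovPoisson.spatialRadius R F f t < |x|) :
    VlasovPoisson.electricField F f t x =
        VlasovPoisson.initialFieldStrength R F f₀ * VlasovPoisson.sgn x *
          Real.cos (VlasovPoisson.frequency F * t) ∧
      ∀ v : ℝ, f t x v =
        F (v + VlasovPoisson.initialFieldStrength R F f₀ * VlasovPoisson.sgn x /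
          VlasovPoisson.frequency F * Real.sin (VlasovPoisson.frequency F * t)) := by
  obtain ⟨B, P, hP, hfB, hFB, hfP, hFP⟩ := hf.exists_bound hT hdata hE.1
  have hb : VlasovPoisson.HasVelocityBound T B P F f := ⟨hP, hfB, hFB, hfP, hFP⟩
  obtain ⟨hcos, hsin⟩ := hf.halfCharge_eq_cos hT hdata hE.1 hb ht
  refine ⟨?_, fun v => ?_⟩
  · rw [hf.electricField_exterior hT hdata hE.1 hb ht hx, hcos]
    ring
  · rw [hf.eq_translate_exterior hT hdata hE.1 hb ht hx]
    -- When `ω = 0` the quotient is a junk value, but `F` vanishes identically and its argument is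
    -- irrelevant.
    by_cases hω : VlasovPoisson.frequency F = 0
    · simp [hdata.background_eq_zero_of_frequency hω]
    · congr 2
      field_simp
      linear_combination VlasovPoisson.sgn x * hsin
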